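/- Throughout, graphs are finite and simple. Fix an integer $d\ge 0$ and let $\mathcal G_d$ be the class of graphs of maximum degree at most $d$. Let $\Pi$ be a parameterized graph problem, that is, an isomorphism-invariant set of pairs $(G,k)$ of a graph $G$ and an integer $k$; instances have $k\ge 0$, and (as is usual when parameters are shifted) either no pair with negative parameter belongs to $\Pi$, or all such pairs do. For an integer $t\ge0$, a $t$-boundaried graph is a graph with $t$ distinct vertices labelled $1,\dots,t$, and $G_1\oplus G_2$ denotes the graph obtained from the disjoint union of two $t$-boundaried graphs by identifying vertices with the same label (parallel edges are merged). For $t$-boundaried graphs $G_1,G_2\in\mathcal G_d$ write $G_1\equiv_t G_2$ if there is an integer $c$ such that for all $t$-boundaried graphs $G_3$: (1) $G_1\oplus G_3\in\mathcal G_d$ iff $G_2\oplus G_3\in\mathcal G_d$; and (2) if these graphs are in $\mathcal G_d$, then for all integers $k$, $(G_1\oplus G_3,k)\in\Pi$ iff $(G_2\oplus G_3,k+c)\in\Pi$. Assume that $\Pi$ has *finite integer index* on $\mathcal G_d$: for every $t\ge 0$, the equivalence relation $\equiv_t$ on the $t$-boundaried graphs in $\mathcal G_d$ has finitely many classes. Assume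 also that $\Pi$ is *treewidth-bounding* on $\mathcal G_d$: there are constants $c,t$ such that for every $(G,k)\in\Pi$ with $G\in\mathcal G_d$ and $k\ge0$ there is a set $X\subseteq V(G)$ with $|X|\le ck$ such that $G-X$ has treewidth at most $t$. Then $\Pi$ admits a linear kernel on $\mathcal G_d$: there are a constant $C$ and an algorithm that, given $G\in\mathcal G_d$ and $k\ge 0$, outputs in time polynomial in $|V(G)|+k$ a graph $G'\in\mathcal G_d$ and an integer $k'\ge0$ such that $(G,k)\in\Pi$ iff $(G',k')\in\Pi$, $|V(G')|+|E(G')|\le C(k+1)$ and $k'\le C(k+1)$. -/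

import Mathlib

/-! ### Finite graphs, graph classes and parameterized graph problems -/

/-- A finite simple graph, on the vertex set `Fin n`. -/
structure FinGraph where
  n : ℕ
  graph : SimpleGraph (Fin n)

namespace FinGraph

/-- A copy, on `Fin (card V)`, of a graph on an arbitrary finite vertex type `V`. -/
noncomputable def of {V : Type} [Fintype V] (G : SimpleGraph V) : FinGraph :=
  ⟨Fintype.card V, G.overFin rfl⟩

/-- The size of a graph: number of vertices plus number of edges. -/
noncomputable def size (G : FinGraph) : ℕ := G.n + G.graph.edgeSet.ncard

end FinGraph

open Classical in
/-- The class of graphs of maximum degree (at most) `d`. -/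
def boundedDegreeClass (d : ℕ) : Set FinGraph := {G | G.graph.maxDegree ≤ d}

/-- A parameterized graph problem: an isomorphism-invariant set of pairs `(G, k)`.  The instances
proper are the pairs with `k ≥ 0`.  Since finite integer index shifts parameters by integers,
membership is also fixed for negative parameters, in the usual way: either none of the pairs
with a negative parameter belongs to the problem, or all of them do. -/
structure ParamGraphProblem where
  Mem : FinGraph → ℤ → Prop
  iso_invariant : ∀ (G H : FinGraph) (k : ℤ), Nonempty (G.graph ≃g H.graph) → (Mem G k ↔ Mem H k)
  neg_const : ∀ (G H : FinGraph) (k l : ℤ), k < 0 → l < 0 → (Mem G k ↔ Mem H l)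

/-! ### Treewidth -/

/-- A tree-decomposition of a graph: a finite tree with a bag at each of its nodes. -/
structure TreeDecomposition {V : Type} (G : SimpleGraph V) where
  Node : Type
  [fintypeNode : Fintype Node]
  tree : SimpleGraph Node
  isTree : tree.IsTree
  bag : Node → Set V
  vertex_mem : ∀ v : V, ∃ i, v ∈ bag i
  edge_mem : ∀ u v : V, G.Adj u v → ∃ i, u ∈ bag i ∧ v ∈ bag i
  subtree : ∀ v : V, (tree.induce {i | v ∈ bag i}).Connected

/-- `tw(G) ≤ t`: some tree-decomposition of `G` has width at most `t`, that is, all its bags have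
at most `t + 1` vertices. -/
def TreewidthLE {V : Type} (G : SimpleGraph V) (t : ℕ) : Prop :=
  ∃ D : TreeDecomposition G, ∀ i, (D.bag i).encard ≤ (t : ℕ∞) + 1

/-- `P` is treewidth-bounding on the class `𝒢`: there are constants `c`, `t` such that every
yes-instance `(G, k)` with `G ∈ 𝒢` has a vertex set `X` with `|X| ≤ c k` and `tw(G - X) ≤ t`. -/
def ParamGraphProblem.TreewidthBounding (P : ParamGraphProblem) (𝒢 : Set FinGraph) : Prop :=
  ∃ c t : ℕ, ∀ G ∈ 𝒢, ∀ k : ℕ, P.Mem G k →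
    ∃ X : Finset (Fin G.n), X.card ≤ c * k ∧
      TreewidthLE (G.graph.induce {v | v ∉ X}) t

/-! ### Boundaried graphs, gluing and finite integer index -/

/-- A `t`-boundaried graph: a graph with `t` distinct vertices labelled by `Fin t`. -/
structure BoundariedGraph (t : ℕ) extends FinGraph where
  terminal : Fin t ↪ Fin n

namespace BoundariedGraph

variable {t : ℕ}

/-- The vertices of `A ⊕ B`: those of `A` and the non-terminals of `B` (the terminals of `B` are
identified with those of `A`). -/
abbrev GlueVertex (A B : BoundariedGraph t) : Type :=
  Fin A.n ⊕ {v : Fin B.n // v ∉ Set.range B.terminal}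

open Classical in
/-- The vertex of `A ⊕ B` that comes from a vertex of `B`: the terminal of `B` with label `i` goes
to the terminal of `A` with label `i`. -/
noncomputable def glueRight (A B : BoundariedGraph t) (v : Fin B.n) : GlueVertex A B :=
  if h : ∃ i, B.terminal i = v then Sum.inl (A.terminal h.choose) else Sum.inr ⟨v, h⟩

open Classical in
/-- The gluing `A ⊕ B`: the disjoint union of `A` and `B` in which terminals with the same label
are identified (parallel edges are merged). -/
noncomputable def glue (A B : BoundariedGraph t) : FinGraph :=
  FinGraph.of ((A.graph.map Sum.inl ⊔ B.graph.map (glueRight A B) :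
    SimpleGraph (GlueVertex A B)))

end BoundariedGraph

namespace ParamGraphProblem

/-- The `t`-boundaried graphs whose underlying graph is in the class `𝒢`. -/
abbrev BoundariedIn (𝒢 : Set FinGraph) (t : ℕ) : Type :=
  {A : BoundariedGraph t // A.toFinGraph ∈ 𝒢}

/-- The equivalence of `t`-boundaried graphs of the class `𝒢`: for some integer `c` and all
`t`-boundaried graphs `C` and all `k`, `A ⊕ C ∈ 𝒢` iff `B ⊕ C ∈ 𝒢`, and
`(A ⊕ C, k) ∈ P` iff `(B ⊕ C, k + c) ∈ P`.  Since `P` is considered on `𝒢` only, the second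
condition speaks about glued graphs that lie in `𝒢`. -/
def Equiv (P : ParamGraphProblem) (𝒢 : Set FinGraph) (t : ℕ) (A B : BoundariedIn 𝒢 t) : Prop :=
  ∃ c : ℤ, ∀ C : BoundariedGraph t,
    (A.1.glue C ∈ 𝒢 ↔ B.1.glue C ∈ 𝒢) ∧
    (A.1.glue C ∈ 𝒢 → ∀ k : ℤ, P.Mem (A.1.glue C) k ↔ P.Mem (B.1.glue C) (k + c))

theorem equiv_equivalence (P : ParamGraphProblem) (𝒢 : Set FinGraph) (t : ℕ) :
    Equivalence (P.Equiv 𝒢 t) where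
  refl A := ⟨0, fun C => ⟨Iff.rfl, fun _ k => by rw [add_zero]⟩⟩
  symm := by
    rintro A B ⟨c, h⟩
    refine ⟨-c, fun C => ⟨(h C).1.symm, fun hB k => ?_⟩⟩
    rw [(h C).2 ((h C).1.2 hB) (k + -c), neg_add_cancel_right]
  trans := by
    rintro A B D ⟨c, h⟩ ⟨e, h'⟩
    refine ⟨c + e, fun C => ⟨(h C).1.trans (h' C).1, fun hA k => ?_⟩⟩
    rw [(h C).2 hA k, (h' C).2 ((h C).1.1 hA) (k + c), add_assoc]

/-- `≡` as a setoid on the `t`-boundaried graphs of `𝒢`. -/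
def equivSetoid (P : ParamGraphProblem) (𝒢 : Set FinGraph) (t : ℕ) : Setoid (BoundariedIn 𝒢 t) :=
  ⟨P.Equiv 𝒢 t, P.equiv_equivalence 𝒢 t⟩

/-- `P` has finite integer index in `𝒢`: for every `t`, the equivalence has finitely many
classes. -/
def FiniteIntegerIndex (P : ParamGraphProblem) (𝒢 : Set FinGraph) : Prop :=
  ∀ t : ℕ, Finite (Quotient (P.equivSetoid 𝒢 t))

end ParamGraphProblem

/-! ### A random access machine with a step count

Programs work on natural-number variables `x₀, x₁, …` and on arrays `A₀, A₁, …`, whose cells are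
addressed by two natural numbers.  Every operation costs one step.  The only arithmetic is addition
and (truncated) subtraction, so that a run of `T` steps creates numbers of `O(T)` more bits only;
this model is polynomially equivalent to Turing machines. -/

namespace RAM

/-- Memory: the variables and the arrays. -/
structure State where
  var : ℕ → ℕ
  arr : ℕ → ℕ → ℕ → ℕ

inductive Expr : Type
  | const (c : ℕ)
  | var (x : ℕ)
  | read (a : ℕ) (i j : Expr)
  | add (e f : Expr)
  | sub (e f : Expr)

namespace Expr

def eval (σ : State) : Expr → ℕ
  | const c => c
  | var x => σ.var x
  | read a i j => σ.arr a (i.eval σ) (j.eval σ)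
  | add e f => e.eval σ + f.eval σ
  | sub e f => e.eval σ - f.eval σ

/-- The number of operations performed when an expression is evaluated. -/
def cost : Expr → ℕ
  | const _ => 1
  | var _ => 1
  | read _ i j => i.cost + j.cost + 1
  | add e f => e.cost + f.cost + 1
  | sub e f => e.cost + f.cost + 1

end Expr

inductive Prog : Type
  | assign (x : ℕ) (e : Expr)
  | write (a : ℕ) (i j e : Expr)
  | seq (p q : Prog)
  | ite (e : Expr) (p q : Prog)
  | while (e : Expr) (p : Prog)

namespace State

/-- The state after the assignment `x := v`. -/
def setVar (σ : State) (x v : ℕ) : State :=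
  { σ with var := fun y => if y = x then v else σ.var y }

/-- The state after the assignment `a[i, j] := v`. -/
def setArr (σ : State) (a i j v : ℕ) : State :=
  { σ with arr := fun b r s => if b = a ∧ r = i ∧ s = j then v else σ.arr b r s }

end State

/-- `Exec p σ τ T`: started in the memory state `σ`, the program `p` halts in the state `τ` after
`T` steps. A test counts as true when its value is not `0`. -/
inductive Exec : Prog → State → State → ℕ → Prop
  | assign (x : ℕ) (e : Expr) (σ : State) :
      Exec (.assign x e) σ (σ.setVar x (e.eval σ)) (e.cost + 1)
  | write (a : ℕ) (i j e : Expr) (σ : State) :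
      Exec (.write a i j e) σ (σ.setArr a (i.eval σ) (j.eval σ) (e.eval σ))
        (i.cost + j.cost + e.cost + 1)
  | seq (p q : Prog) (σ τ υ : State) (S T : ℕ) :
      Exec p σ τ S → Exec q τ υ T → Exec (.seq p q) σ υ (S + T + 1)
  | ite_true (e : Expr) (p q : Prog) (σ τ : State) (T : ℕ) :
      e.eval σ ≠ 0 → Exec p σ τ T → Exec (.ite e p q) σ τ (e.cost + T + 1)
  | ite_false (e : Expr) (p q : Prog) (σ τ : State) (T : ℕ) :
      e.eval σ = 0 → Exec q σ τ T → Exec (.ite e p q) σ τ (e.cost + T + 1)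
  | while_done (e : Expr) (p : Prog) (σ : State) :
      e.eval σ = 0 → Exec (.while e p) σ σ (e.cost + 1)
  | while_step (e : Expr) (p : Prog) (σ τ υ : State) (S T : ℕ) :
      e.eval σ ≠ 0 → Exec p σ τ S → Exec (.while e p) τ υ T →
      Exec (.while e p) σ υ (e.cost + S + T + 1)

open Classical in
/-- The initial memory for the instance `(G, k)`: the number of vertices in `x₀`, the parameter in
`x₁`, the adjacency matrix in `A₀`, and `0` everywhere else. -/
noncomputable def input (G : FinGraph) (k : ℕ) : State where
  var x := if x = 0 then G.n else if x = 1 then k else 0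
  arr a i j := if a = 0 ∧ ∃ (hi : i < G.n) (hj : j < G.n), G.graph.Adj ⟨i, hi⟩ ⟨j, hj⟩ then 1 else 0

open Classical in
/-- The memory holds the instance `(G, k)`: the number of vertices in `x₀`, the parameter in `x₁`
and the adjacency matrix in the top left corner of `A₀`. -/
def Outputs (σ : State) (G : FinGraph) (k : ℕ) : Prop :=
  σ.var 0 = G.n ∧ σ.var 1 = k ∧
    ∀ i j : Fin G.n, σ.arr 0 i j = if G.graph.Adj i j then 1 else 0

end RAM

/-! ### Linear kernels -/

/-- `P` admits a linear kernel on the class `𝒢`: there is an algorithm that, given an instance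
`(G, k)` with `G ∈ 𝒢`, runs in time polynomial in `|V(G)| + k` and outputs an equivalent instance
`(G', k')` with `G' ∈ 𝒢`, whose size and parameter are `O(k)`. -/
def ParamGraphProblem.AdmitsLinearKernel (P : ParamGraphProblem) (𝒢 : Set FinGraph) : Prop :=
  ∃ (C : ℕ) (p : Polynomial ℕ) (K : RAM.Prog), ∀ G ∈ 𝒢, ∀ k : ℕ,
    ∃ (G' : FinGraph) (k' : ℕ) (τ : RAM.State) (T : ℕ),
      RAM.Exec K (RAM.input G k) τ T ∧ T ≤ p.eval (G.n + k) ∧ RAM.Outputs τ G' k' ∧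
      G' ∈ 𝒢 ∧ (P.Mem G k ↔ P.Mem G' k') ∧
      G'.size ≤ C * (k + 1) ∧ k' ≤ C * (k + 1)

/-! ### Small pieces of graphs of bounded treewidth -/

namespace SimpleGraph

/-! The kernel replaces protrusions: pieces of bounded size attached to the rest of the graph along
boundedly many vertices.

Structure. Let `(G, k)` be a yes-instance and let `X` be a set of at most `c * k` vertices whose
removal leaves treewidth at most `t`. As degrees are at most `d`, only `d * |X|` vertices outside
`X` touch `X`. If the graph is larger than a suitable multiple of `k + 1`, most of it lies outside
`X` and has small boundary relative to its size. Contracting leaves of a tree-decomposition cuts off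
a piece with more than `s` and at most `2 * s` vertices that meets the rest of the remaining part
along one bag (`SimpleGraph.exists_piece_of_tree`). Either this piece has small boundary in the
whole graph, or it swallows many old boundary vertices; then discarding it lowers the boundary
faster than the size, and the argument repeats (`SimpleGraph.exists_piece_small_boundary`).

Replacement. Finite integer index gives finitely many classes of boundaried graphs with a bounded
number of terminals. Since the answer is constant on negative parameters, each class has a
representative towards which the parameter never increases (`exists_progressive_representative`).
Taking `s` larger than all these representatives, every piece of moderate size can be exchanged for
a strictly smaller one, and the needed exchanges form a finite table that is built into the program
(`FiniteIntegerIndex.exists_replacements`).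

Algorithm. Neither `X` nor a tree-decomposition is ever computed. The program tries all tuples of
vertices against all patterns of the table until no pattern occurs; each success deletes a vertex,
so the time is polynomial. An irreducible instance that is still too large is a no-instance by the
structural part, and one with negative parameter has a known answer. In both cases a constant
instance is output; otherwise the reduced instance is the kernel. -/

/-- In a nontrivial finite tree there is a node with a unique neighbour. -/
theorem IsTree.exists_leaf {ι : Type*} [Finite ι] [Nontrivial ι] {T : SimpleGraph ι}
    (hT : T.IsTree) : ∃ l p, T.Adj l p ∧ ∀ q, T.Adj l q → q = p := by
  classical
  have := Fintype.ofFinite ι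
  obtain ⟨l, hl⟩ := hT.exists_vert_degree_one_of_nontrivial
  obtain ⟨p, hp, h⟩ := degree_eq_one_iff_existsUnique_adj.1 hl
  exact ⟨l, p, hp, h⟩

/-- Inside `s` the leaf `l` has at most one neighbour, so no path between two other nodes needs it.
This keeps the trace of a vertex connected when a leaf is contracted. -/
theorem induce_leaf_preconnected {ι : Type*} {T : SimpleGraph ι} {l p : ι}
    (h : ∀ q, T.Adj l q → q = p) {s : Set ι} (hs : (T.induce s).Preconnected) :
    ((T.induce {l}ᶜ).induce {i | i.1 ∈ s}).Preconnected := by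
  have h1 : ((T.induce s).induce {x | x.1 ≠ l}).Preconnected := by
    refine hs.induce_of_degree_eq_one fun v hv => ?_
    have hv : v.1 = l := by simpa using hv
    intro a ha b hb
    have ha' : T.Adj v a := ha
    have hb' : T.Adj v b := hb
    rw [hv] at ha' hb'
    exact Subtype.ext ((h _ ha').trans (h _ hb').symm)
  let f : (T.induce s).induce {x | x.1 ≠ l} →g (T.induce {l}ᶜ).induce {i | i.1 ∈ s} :=
    { toFun := fun x => ⟨⟨x.1.1, x.2⟩, x.1.2⟩
      map_rel' := fun {a b} hab => hab }
  exact h1.map f fun y => ⟨⟨⟨y.1.1, y.2⟩, y.1.2⟩, rfl⟩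

/-- A leaf of a connected subset of a tree has its neighbour in the subset. -/
theorem leaf_neighbour_mem {ι : Type*} {T : SimpleGraph ι} {l p j : ι}
    (h : ∀ q, T.Adj l q → q = p) {s : Set ι} (hs : (T.induce s).Preconnected)
    (hl : l ∈ s) (hj : j ∈ s) (hne : j ≠ l) : p ∈ s := by
  obtain ⟨w⟩ := hs ⟨l, hl⟩ ⟨j, hj⟩
  cases w with
  | nil => exact absurd rfl hne
  | @cons _ q _ hadj _ =>
    have : T.Adj l q.1 := hadj
    rw [← h _ this]
    exact q.2

/-- A tree-decomposition with bags of size at most `s`, in which only a part `B i` of size at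
most `b` of the bag `A i` is shared with other bags, has a piece of size between `s` and `2 * s`
that is attached along at most `b` vertices. -/
theorem exists_piece_of_tree {V : Type*} [Fintype V] [DecidableEq V] (G : SimpleGraph V)
    (s b : ℕ) (hs : s < Fintype.card V) (m : ℕ) : ∀ (ι : Type) [Fintype ι] (T : SimpleGraph ι)
    (A B : ι → Finset V), Fintype.card ι ≤ m → T.IsTree → (∀ i, B i ⊆ A i) →
    (∀ i, (B i).card ≤ b) → (∀ i, (A i).card ≤ s) → (∀ i j, i ≠ j → A i ∩ A j ⊆ B i) →
    (∀ u v, G.Adj u v → ∃ i, u ∈ A i ∧ v ∈ A i) → (∀ v, ∃ i, v ∈ A i) →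
    (∀ v, (T.induce {i | v ∈ A i}).Preconnected) →
    ∃ W Z : Finset V, Z ⊆ W ∧ s < W.card ∧ W.card ≤ 2 * s ∧ Z.card ≤ b ∧
      ∀ v ∈ W, v ∉ Z → ∀ u, G.Adj v u → u ∈ W := by
  classical
  induction m with
  | zero =>
    intro ι _ T A B hm hT
    have := hT.connected.nonempty
    exact absurd hm (by simp)
  | succ m ih =>
    intro ι _ T A B hm hT hBA hB hA hpriv hedge hvert hconn
    rcases subsingleton_or_nontrivial ι with hsub | hnt
    · obtain ⟨i⟩ := hT.connected.nonempty
      have : (Finset.univ : Finset V) ⊆ A i := fun v _ => by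
        obtain ⟨j, hj⟩ := hvert v
        rwa [Subsingleton.elim i j]
      have := (Finset.card_le_card this).trans (hA i)
      rw [Finset.card_univ] at this
      omega
    obtain ⟨l, p, hlp, hl⟩ := hT.exists_leaf
    have hleaf : ∀ v j, v ∈ A l → v ∈ A j → j ≠ l → v ∈ A p := fun v j h1 h2 h3 =>
      leaf_neighbour_mem hl (hconn v) h1 h2 h3
    have hshare : ∀ v j, v ∈ A p ∪ A l → v ∈ A j → j ≠ p → j ≠ l → v ∈ B p := by
      intro v j h1 h2 h3 h4
      have hp : v ∈ A p := by
        rcases Finset.mem_union.1 h1 with h | h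
        · exact h
        · exact hleaf v j h h2 h4
      exact hpriv p j h3.symm (Finset.mem_inter.2 ⟨hp, h2⟩)
    -- Two sets of size at most `s` have a union of size at most `2 * s`. Either the union is
    -- already a piece, or the leaf can be absorbed by its neighbour without exceeding `s`.
    by_cases hbig : s < (A p ∪ A l).card
    · refine ⟨A p ∪ A l, B p, (hBA p).trans Finset.subset_union_left, hbig, ?_, hB p, ?_⟩
      · have := Finset.card_union_le (A p) (A l)
        have := hA p
        have := hA l
        omega
      · intro v hv hvB u huv
        obtain ⟨j, hj1, hj2⟩ := hedge _ _ huv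
        by_cases h1 : j = p
        · subst h1; exact Finset.mem_union_left _ hj2
        by_cases h2 : j = l
        · subst h2; exact Finset.mem_union_right _ hj2
        exact absurd (hshare v j hv hj1 h1 h2) hvB
    · have hpl : p ≠ l := hlp.ne'
      -- Contracting `l` into `p` enlarges `A p` but leaves `B p` alone: what the merged node shares
      -- with the remaining nodes was in `A p` before, hence in `B p`.
      let A' : ι → Finset V := fun i => if i = p then A p ∪ A l else A i
      have hA'p : A' p = A p ∪ A l := if_pos rfl
      have hA'n : ∀ i, i ≠ p → A' i = A i := fun i hi => if_neg hi
      have hAA' : ∀ i, A i ⊆ A' i := fun i => by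
        by_cases hi : i = p
        · subst hi; rw [hA'p]; exact Finset.subset_union_left
        · rw [hA'n i hi]
      have hfind : ∀ i, ∃ j : ({l}ᶜ : Set ι), A i ⊆ A' j.1 := fun i => by
        by_cases hi : i = l
        · exact ⟨⟨p, hpl⟩, by rw [hi]; simp only [hA'p]; exact Finset.subset_union_right⟩
        · exact ⟨⟨i, hi⟩, hAA' i⟩
      have hdeg : (T.induce ({l}ᶜ : Set ι)).IsTree := by
        refine ⟨?_, hT.isAcyclic.induce _⟩
        have : Nonempty ({l}ᶜ : Set ι) := ⟨⟨p, hpl⟩⟩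
        refine ⟨hT.connected.preconnected.induce_of_degree_eq_one fun v hv => ?_⟩
        have hv : v = l := by simpa using hv
        subst hv
        exact fun a ha b hb => (hl _ ha).trans (hl _ hb).symm
      refine ih ({l}ᶜ : Set ι) (T.induce {l}ᶜ) (fun i => A' i) (fun i => B i) ?_ hdeg
        (fun i => (hBA i).trans (hAA' i)) (fun i => hB i) ?_ ?_ ?_ ?_ ?_
      · have : Fintype.card ({l}ᶜ : Set ι) < Fintype.card ι :=
          Fintype.card_subtype_lt (x := l) (by simp)
        omega
      · intro i
        by_cases hi : i.1 = p
        · simp only [hi, hA'p]; omega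
        · simp only [hA'n _ hi]; exact hA _
      · intro i j hij v hv
        have hij' : i.1 ≠ j.1 := fun h => hij (Subtype.ext h)
        obtain ⟨h1, h2⟩ := Finset.mem_inter.1 hv
        have hjl : j.1 ≠ l := j.2
        have hil : i.1 ≠ l := i.2
        by_cases hi : i.1 = p
        · have hj : j.1 ≠ p := fun h => hij' (hi.trans h.symm)
          simp only [hi, hA'p] at h1
          simp only [hA'n _ hj] at h2
          simp only [hi]
          exact hshare v j h1 h2 hj hjl
        · simp only [hA'n _ hi] at h1
          by_cases hj : j.1 = p
          · simp only [hj, hA'p] at h2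
            have h3 := hBA p (hshare v i h2 h1 hi hil)
            exact hpriv i p hi (Finset.mem_inter.2 ⟨h1, h3⟩)
          · simp only [hA'n _ hj] at h2
            exact hpriv i j hij' (Finset.mem_inter.2 ⟨h1, h2⟩)
      · intro u v huv
        obtain ⟨i, h1, h2⟩ := hedge u v huv
        obtain ⟨j, hj⟩ := hfind i
        exact ⟨j, hj h1, hj h2⟩
      · intro v
        obtain ⟨i, h1⟩ := hvert v
        obtain ⟨j, hj⟩ := hfind i
        exact ⟨j, hj h1⟩
      · intro v
        -- A vertex private to the leaf now occurs at `p` only. For any other vertex, the nodes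
        -- containing it are the old ones without `l`.
        by_cases hv : v ∈ A l ∧ v ∉ A p
        · have hsub : ∀ x : ({i : ({l}ᶜ : Set ι) | v ∈ A' i} : Set _), x.1.1 = p := by
            rintro ⟨⟨i, hi⟩, hx⟩
            by_contra hne
            have hx : v ∈ A' i := hx
            rw [hA'n i hne] at hx
            exact hv.2 (hleaf v i hv.1 hx hi)
          intro x y
          have : x = y := Subtype.ext (Subtype.ext ((hsub x).trans (hsub y).symm))
          rw [this]
        · have hset : {i : ({l}ᶜ : Set ι) | v ∈ A' i} = {i | i.1 ∈ {i | v ∈ A i}} := by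
            ext i
            change v ∈ A' i ↔ v ∈ A i
            by_cases hi : i.1 = p
            · rw [hi, hA'p, Finset.mem_union]
              tauto
            · rw [hA'n _ hi]
          rw [hset]
          exact induce_leaf_preconnected hl (hconn v)

end SimpleGraph

theorem TreewidthLE.comap {V W : Type} {G : SimpleGraph V} {H : SimpleGraph W} {t : ℕ}
    (h : TreewidthLE G t) (f : H ↪g G) : TreewidthLE H t := by
  obtain ⟨D, hD⟩ := h
  have := D.fintypeNode
  refine ⟨{ Node := D.Node
            tree := D.tree
            isTree := D.isTree
            bag := fun i => f ⁻¹' D.bag i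
            vertex_mem := fun v => D.vertex_mem (f v)
            edge_mem := fun u v huv => D.edge_mem _ _ (f.map_rel_iff.2 huv)
            subtree := fun v => D.subtree (f v) }, fun i => ?_⟩
  refine le_trans ?_ (hD i)
  rw [← f.injective.encard_image]
  exact Set.encard_le_encard (Set.image_preimage_subset _ _)

/-- The contraction starts with `A` and `B` both equal to the bags. The sets `B` never change, so
the attachment set `Z` is one original bag. -/
theorem TreewidthLE.exists_piece {V : Type} [Fintype V] [DecidableEq V] {G : SimpleGraph V}
    {t s : ℕ} (h : TreewidthLE G t) (hts : t + 1 ≤ s) (hs : s < Fintype.card V) :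
    ∃ W Z : Finset V, Z ⊆ W ∧ s < W.card ∧ W.card ≤ 2 * s ∧ Z.card ≤ t + 1 ∧
      ∀ v ∈ W, v ∉ Z → ∀ u, G.Adj v u → u ∈ W := by
  classical
  obtain ⟨D, hD⟩ := h
  have := D.fintypeNode
  have hcard : ∀ i, (D.bag i).toFinset.card ≤ t + 1 := fun i => by
    have := hD i
    rw [Set.encard_eq_coe_toFinset_card] at this
    exact_mod_cast this
  refine SimpleGraph.exists_piece_of_tree G s (t + 1) hs _ D.Node D.tree
    (fun i => (D.bag i).toFinset) (fun i => (D.bag i).toFinset) le_rfl D.isTree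
    (fun i => Finset.Subset.refl _) hcard (fun i => (hcard i).trans hts)
    (fun i j _ => Finset.inter_subset_left) ?_ ?_ ?_
  · simpa using D.edge_mem
  · simpa using D.vertex_mem
  · intro v
    have hset : {i | v ∈ (D.bag i).toFinset} = {i | v ∈ D.bag i} := by ext i; simp
    rw [hset]
    exact (D.subtree v).preconnected

/-! ### Small pieces with small boundary -/

namespace SimpleGraph

variable {V : Type} [Fintype V] [DecidableEq V]

open Classical in
/-- The vertices of `U` that have a neighbour outside `U`. -/
noncomputable def boundary (G : SimpleGraph V) (U : Finset V) : Finset V :=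
  {v ∈ U | ∃ u, u ∉ U ∧ G.Adj v u}

theorem mem_boundary {G : SimpleGraph V} {U : Finset V} {v : V} :
    v ∈ G.boundary U ↔ v ∈ U ∧ ∃ u, u ∉ U ∧ G.Adj v u := by
  simp [boundary]

open Classical in
/-- A set `Z` in a graph of maximum degree `d` has at most `d * |Z|` neighbours. -/
theorem card_biUnion_neighborFinset_le {G : SimpleGraph V} {d : ℕ} (hd : G.maxDegree ≤ d)
    (Z : Finset V) : (Z.biUnion fun v => G.neighborFinset v).card ≤ Z.card * d :=
  Finset.card_biUnion_le_card_mul _ _ _ fun v _ => (G.degree_le_maxDegree v).trans hd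

-- Induction on the boundary of `U`. A piece `W` cut off along `Z` has its boundary in `Z ∪ (W ∩
-- ∂U)`. If that is too large, `W` contains more than `(t + 1) * d` vertices of `∂U`, while removing
-- `W` from `U` creates at most `(t + 1) * d` new boundary vertices, the neighbours of `Z`. So the
-- boundary shrinks.
open Classical in
theorem exists_piece_small_boundary {G : SimpleGraph V} {d t s : ℕ} (hd : G.maxDegree ≤ d)
    (hts : t + 1 ≤ s) (m : ℕ) : ∀ U : Finset V, (G.boundary U).card ≤ m →
    TreewidthLE (G.induce {v | v ∈ U}) t → 2 * s * (G.boundary U).card + s < U.card →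
    ∃ W : Finset V, s < W.card ∧ W.card ≤ 2 * s ∧
      (G.boundary W).card ≤ t + 1 + (t + 1) * d + 1 := by
  induction m using Nat.strong_induction_on with
  | _ m ih =>
  intro U hm htw hU
  obtain ⟨W₀, Z₀, hZW₀, hW1, hW2, hZ, hnb⟩ := htw.exists_piece hts (by
    have : Fintype.card ({v | v ∈ U} : Set V) = U.card := by simp
    have h2 : U.card = Fintype.card ({v | v ∈ U} : Set V) := this.symm
    have : s < U.card := by omega
    convert h2 ▸ this)
  let ψ : ({v | v ∈ U} : Set V) ↪ V := Function.Embedding.subtype _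
  obtain ⟨W, hW⟩ : ∃ W, W = W₀.map ψ := ⟨_, rfl⟩
  obtain ⟨Z, hZe⟩ : ∃ Z, Z = Z₀.map ψ := ⟨_, rfl⟩
  have hWU : W ⊆ U := by
    intro v hv
    rw [hW, Finset.mem_map] at hv
    obtain ⟨x, -, rfl⟩ := hv
    exact x.2
  have hnb' : ∀ v ∈ W, v ∉ Z → ∀ u ∈ U, G.Adj v u → u ∈ W := by
    intro v hv hvZ u hu huv
    rw [hW, Finset.mem_map] at hv ⊢
    obtain ⟨x, hx, rfl⟩ := hv
    refine ⟨⟨u, hu⟩, hnb x hx (fun hxZ => hvZ ?_) _ huv, rfl⟩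
    rw [hZe]
    exact Finset.mem_map_of_mem _ hxZ
  have hWc : W.card = W₀.card := by rw [hW, Finset.card_map]
  have hZc : Z.card ≤ t + 1 := by rw [hZe, Finset.card_map]; exact hZ
  by_cases hb : (G.boundary W).card ≤ t + 1 + (t + 1) * d + 1
  · exact ⟨W, by omega, by omega, hb⟩
  have h1 : G.boundary W ⊆ Z ∪ (W ∩ G.boundary U) := by
    intro v hv
    obtain ⟨hvW, u, huW, huv⟩ := mem_boundary.1 hv
    rw [Finset.mem_union, Finset.mem_inter]
    by_cases hvZ : v ∈ Z
    · exact Or.inl hvZ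
    · exact Or.inr ⟨hvW, mem_boundary.2 ⟨hWU hvW, u, fun huU => huW (hnb' v hvW hvZ u huU huv),
        huv⟩⟩
  have h2 : G.boundary (U \ W) ⊆ (G.boundary U \ W) ∪ Z.biUnion fun v => G.neighborFinset v := by
    intro v hv
    obtain ⟨hvU, u, hu, huv⟩ := mem_boundary.1 hv
    obtain ⟨hvU, hvW⟩ := Finset.mem_sdiff.1 hvU
    rw [Finset.mem_union]
    by_cases huU : u ∈ U
    · have huW : u ∈ W := by
        by_contra h
        exact hu (Finset.mem_sdiff.2 ⟨huU, h⟩)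
      refine Or.inr (Finset.mem_biUnion.2 ⟨u, ?_, by simpa using huv.symm⟩)
      by_contra huZ
      exact hvW (hnb' u huW huZ v hvU huv.symm)
    · exact Or.inl (Finset.mem_sdiff.2 ⟨mem_boundary.2 ⟨hvU, u, huU, huv⟩, hvW⟩)
  have c1 := (Finset.card_le_card h1).trans (Finset.card_union_le _ _)
  have c2 := (Finset.card_le_card h2).trans (Finset.card_union_le _ _)
  have c3 := card_biUnion_neighborFinset_le hd Z
  have c4 : (G.boundary U \ W).card + (W ∩ G.boundary U).card = (G.boundary U).card := by
    rw [Finset.inter_comm]; exact Finset.card_sdiff_add_card_inter _ _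
  have c5 : (U \ W).card + W.card = U.card := Finset.card_sdiff_add_card_eq_card hWU
  have c6 : Z.card * d ≤ (t + 1) * d := Nat.mul_le_mul_right _ hZc
  have hlt : (G.boundary (U \ W)).card + 1 ≤ (G.boundary U).card := by omega
  -- One boundary vertex fewer releases `2 * s` in the size hypothesis, which pays for the at most
  -- `2 * s` vertices of `W`.
  have c7 : 2 * s * ((G.boundary (U \ W)).card + 1) ≤ 2 * s * (G.boundary U).card :=
    Nat.mul_le_mul_left _ hlt
  rw [Nat.mul_add, Nat.mul_one] at c7
  refine ih (G.boundary (U \ W)).card (by omega) (U \ W) le_rfl ?_ (by omega)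
  exact htw.comap (SimpleGraph.induceHomOfLE G
    (s := {v | v ∈ U \ W}) (s' := {v | v ∈ U}) fun v hv => (Finset.mem_sdiff.1 hv).1)

open Classical in
/-- A set of vertices that leaves a graph of bounded treewidth and is small in comparison with the
graph forces a piece of bounded size with a boundary of bounded size. -/
theorem exists_piece_of_treewidth_deletion {G : SimpleGraph V} {d t s : ℕ} (hd : G.maxDegree ≤ d)
    (hts : t + 1 ≤ s) (X : Finset V) (htw : TreewidthLE (G.induce {v | v ∉ X}) t)
    (hX : 2 * s * (X.card * d) + s + X.card < Fintype.card V) :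
    ∃ W : Finset V, s < W.card ∧ W.card ≤ 2 * s ∧
      (G.boundary W).card ≤ t + 1 + (t + 1) * d + 1 := by
  -- The boundary of the complement of `X` consists of neighbours of `X`.
  have hb : (G.boundary Xᶜ).card ≤ X.card * d := by
    refine (Finset.card_le_card ?_).trans (card_biUnion_neighborFinset_le hd X)
    intro v hv
    obtain ⟨-, u, hu, huv⟩ := mem_boundary.1 hv
    exact Finset.mem_biUnion.2 ⟨u, by simpa using hu, by simpa using huv.symm⟩
  refine exists_piece_small_boundary hd hts _ Xᶜ le_rfl ?_ ?_
  · exact htw.comap (SimpleGraph.induceHomOfLE G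
      (s := {v | v ∈ Xᶜ}) (s' := {v | v ∉ X}) fun v hv => by simpa using hv)
  · have := Nat.mul_le_mul_left (2 * s) hb
    rw [Finset.card_compl]
    omega

end SimpleGraph

/-! ### Gluing and replacement -/

namespace BoundariedGraph

variable {t : ℕ}

theorem glueRight_terminal (A C : BoundariedGraph t) (i : Fin t) :
    glueRight A C (C.terminal i) = Sum.inl (A.terminal i) := by
  have h : ∃ j, C.terminal j = C.terminal i := ⟨i, rfl⟩
  rw [glueRight, dif_pos h, C.terminal.injective h.choose_spec]

theorem glueRight_of_notMem (A C : BoundariedGraph t) (v : Fin C.n)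
    (h : v ∉ Set.range C.terminal) : glueRight A C v = Sum.inr ⟨v, h⟩ :=
  dif_neg h

/-- A graph that is covered by copies of `A` and `C` meeting in the terminals only is isomorphic
to `A ⊕ C`. -/
theorem nonempty_glue_iso (A C : BoundariedGraph t) {V : Type} (X : SimpleGraph V)
    (α : Fin A.n → V) (γ : Fin C.n → V) (hα : Function.Injective α) (hγ : Function.Injective γ)
    (hterm : ∀ i, α (A.terminal i) = γ (C.terminal i))
    (hcover : ∀ v, (∃ a, α a = v) ∨ ∃ c, γ c = v)
    (hinter : ∀ a c, α a = γ c → ∃ i, a = A.terminal i)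
    (hadj : ∀ u v, X.Adj u v ↔ (∃ a b, A.graph.Adj a b ∧ α a = u ∧ α b = v) ∨
      ∃ a b, C.graph.Adj a b ∧ γ a = u ∧ γ b = v) :
    Nonempty ((A.glue C).graph ≃g X) := by
  classical
  let Φ : GlueVertex A C → V := Sum.elim α fun x => γ x.1
  have hΦl : ∀ a, Φ (Sum.inl a) = α a := fun _ => rfl
  have hΦr : ∀ c, Φ (glueRight A C c) = γ c := fun c => by
    by_cases h : c ∈ Set.range C.terminal
    · obtain ⟨i, rfl⟩ := h
      rw [glueRight_terminal]
      exact hterm i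
    · rw [glueRight_of_notMem _ _ _ h]; rfl
  have hinj : Function.Injective Φ := by
    have key : ∀ a (x : {v : Fin C.n // v ∉ Set.range C.terminal}), α a ≠ γ x.1 := by
      intro a x h
      obtain ⟨i, rfl⟩ := hinter _ _ h
      exact x.2 ⟨i, hγ ((hterm i).symm.trans h)⟩
    rintro (a | x) (b | y) h
    · exact congrArg _ (hα h)
    · exact absurd h (key a y)
    · exact absurd h.symm (key b x)
    · exact congrArg _ (Subtype.ext (hγ h))
  have hsurj : Function.Surjective Φ := by
    intro v
    rcases hcover v with ⟨a, rfl⟩ | ⟨c, rfl⟩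
    · exact ⟨_, hΦl a⟩
    · exact ⟨_, hΦr c⟩
  let e : (A.graph.map Sum.inl ⊔ C.graph.map (glueRight A C) : SimpleGraph (GlueVertex A C)) ≃g X :=
    { toEquiv := Equiv.ofBijective Φ ⟨hinj, hsurj⟩
      map_rel_iff' := by
        intro x y
        change X.Adj (Φ x) (Φ y) ↔ (x ≠ y ∧ ∃ a b, A.graph.Adj a b ∧ _ = _ ∧ _ = _) ∨
          (x ≠ y ∧ ∃ a b, C.graph.Adj a b ∧ _ = _ ∧ _ = _)
        rw [← and_or_left]
        constructor
        · intro h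
          refine ⟨fun hxy => h.ne (congrArg Φ hxy), ?_⟩
          rcases (hadj _ _).1 h with ⟨a, b, h, h1, h2⟩ | ⟨a, b, h, h1, h2⟩
          · exact Or.inl ⟨a, b, h, hinj h1, hinj h2⟩
          · exact Or.inr ⟨a, b, h, hinj ((hΦr a).trans h1), hinj ((hΦr b).trans h2)⟩
        · rintro ⟨-, ⟨a, b, h, rfl, rfl⟩ | ⟨a, b, h, rfl, rfl⟩⟩
          · exact (hadj _ _).2 (Or.inl ⟨a, b, h, rfl, rfl⟩)
          · exact (hadj _ _).2 (Or.inr ⟨a, b, h, (hΦr a).symm, (hΦr b).symm⟩) }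
  exact ⟨(SimpleGraph.overFinIso _ rfl).symm.trans e⟩

end BoundariedGraph

/-! ### Progressive representatives and the finite table of replacements -/

namespace ParamGraphProblem

open BoundariedGraph

/-- `A` may be replaced by `B` while the parameter drops by `a`. -/
def ShiftsTo (P : ParamGraphProblem) (𝒢 : Set FinGraph) {t : ℕ} (A B : BoundariedGraph t)
    (a : ℕ) : Prop :=
  ∀ C : BoundariedGraph t, (A.glue C ∈ 𝒢 ↔ B.glue C ∈ 𝒢) ∧
    (A.glue C ∈ 𝒢 → ∀ k : ℤ, P.Mem (A.glue C) k ↔ P.Mem (B.glue C) (k - a))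

/-- Every class of boundaried graphs has a representative to which all its members can be
reduced without raising the parameter. -/
theorem exists_progressive_representative (P : ParamGraphProblem) (𝒢 : Set FinGraph) (t : ℕ)
    (q : Quotient (P.equivSetoid 𝒢 t)) :
    ∃ R : BoundariedIn 𝒢 t, ∀ A : BoundariedIn 𝒢 t, Quotient.mk _ A = q →
      ∃ a : ℕ, P.ShiftsTo 𝒢 A.1 R.1 a := by
  classical
  obtain ⟨A₀, hA₀⟩ := Quotient.exists_rep q
  have hcls : ∀ {A B : BoundariedIn 𝒢 t}, Quotient.mk (P.equivSetoid 𝒢 t) A = q →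
      Quotient.mk (P.equivSetoid 𝒢 t) B = q → P.Equiv 𝒢 t A B := fun hA hB =>
    Quotient.exact (hA.trans hB.symm)
  -- The truth value at `-1` is the common answer at all negative parameters. The question is
  -- whether any gluing of a member of the class ever deviates from it.
  by_cases h : ∃ A : BoundariedIn 𝒢 t, Quotient.mk _ A = q ∧ ∃ C : BoundariedGraph t,
      A.1.glue C ∈ 𝒢 ∧ ∃ k : ℤ, ¬ (P.Mem (A.1.glue C) k ↔ P.Mem A₀.1.toFinGraph (-1))
  · obtain ⟨A₁, hA₁, C, hC, k₁, hk₁⟩ := h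
    have hnonneg : ∀ (H : FinGraph) (k : ℤ),
        ¬ (P.Mem H k ↔ P.Mem A₀.1.toFinGraph (-1)) → 0 ≤ k := fun H k hk => by
      by_contra hlt
      exact hk (P.neg_const _ _ _ _ (by omega) (by omega))
    -- With the environment `C` fixed, the representative is a member `R` of the class that deviates
    -- at the least possible parameter `n`. If `A` is related to `R` by the shift `c`, it deviates
    -- at `n - c`, so minimality forces `c ≤ 0`.
    have hex : ∃ n : ℕ, ∃ R : BoundariedIn 𝒢 t, Quotient.mk _ R = q ∧ R.1.glue C ∈ 𝒢 ∧
        ¬ (P.Mem (R.1.glue C) n ↔ P.Mem A₀.1.toFinGraph (-1)) :=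
      ⟨k₁.toNat, A₁, hA₁, hC, by rwa [Int.toNat_of_nonneg (hnonneg _ _ hk₁)]⟩
    obtain ⟨R, hR, hRC, hRk⟩ := Nat.find_spec hex
    refine ⟨R, fun A hA => ?_⟩
    obtain ⟨c, hc⟩ := hcls hA hR
    have hAC : A.1.glue C ∈ 𝒢 := (hc C).1.2 hRC
    have hAk : ¬ (P.Mem (A.1.glue C) ((Nat.find hex : ℤ) - c) ↔ P.Mem A₀.1.toFinGraph (-1)) := by
      rwa [(hc C).2 hAC, sub_add_cancel]
    have h0 := hnonneg _ _ hAk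
    have hc0 : c ≤ 0 := by
      by_contra hlt
      refine Nat.find_min hex (m := ((Nat.find hex : ℤ) - c).toNat) (by omega)
        ⟨A, hA, hAC, ?_⟩
      rwa [Int.toNat_of_nonneg h0]
    refine ⟨(-c).toNat, fun D => ⟨(hc D).1, fun hD k => ?_⟩⟩
    rw [(hc D).2 hD, Int.toNat_of_nonneg (by omega), sub_neg_eq_add]
  -- No answer in the class depends on the parameter or on the graph, so any member serves with
  -- shift `0`.
  · push Not at h
    refine ⟨A₀, fun A hA => ⟨0, fun D => ?_⟩⟩
    obtain ⟨c, hc⟩ := hcls hA hA₀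
    refine ⟨(hc D).1, fun hD k => ?_⟩
    exact (h A hA D hD _).trans (h A₀ hA₀ D ((hc D).1.1 hD) _).symm

/-- A way to replace `A` inside a larger graph by a smaller boundaried graph `R`, whose vertices
take the places of some vertices of `A`. -/
structure Replacement (P : ParamGraphProblem) (𝒢 : Set FinGraph) {t : ℕ}
    (A : BoundariedGraph t) where
  R : BoundariedGraph t
  place : Fin R.n ↪ Fin A.n
  place_terminal : ∀ i, place (R.terminal i) = A.terminal i
  lt : R.n < A.n
  shift : ℕ
  shiftsTo : P.ShiftsTo 𝒢 A R shift

/-- This lets the smaller graph be written over vertices of the larger one, terminals upon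
terminals, so that no new vertex is ever needed. -/
theorem exists_embedding_extending {t m n : ℕ} (f : Fin t ↪ Fin m) (g : Fin t ↪ Fin n)
    (h : m < n) : ∃ π : Fin m ↪ Fin n, ∀ i, π (f i) = g i := by
  classical
  have htm : t ≤ m := by simpa using Fintype.card_le_of_embedding f
  obtain ⟨T, hT, hTc⟩ := Finset.exists_superset_card_eq (s := Finset.univ.map g) (n := m)
    (by simpa using htm) (by simpa using h.le)
  have hF : ∀ i, Function.extend f g (fun _ => ⟨0, by omega⟩) (f i) = g i :=
    fun i => f.injective.extend_apply _ _ _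
  obtain ⟨e, he⟩ := Finset.exists_equiv_extend_of_card_eq (α := Fin m) (t := T)
    (by simpa using hTc.symm) (s := Finset.univ.map f)
    (f := Function.extend f g fun _ => ⟨0, by omega⟩) (by
      intro x hx
      simp only [Finset.mem_image, Finset.mem_map, Finset.mem_univ, true_and] at hx
      obtain ⟨_, ⟨i, rfl⟩, rfl⟩ := hx
      rw [hF]
      exact hT (Finset.mem_map_of_mem _ (Finset.mem_univ _))) (by
      intro x hx y hy hxy
      simp only [Finset.coe_map, Finset.coe_univ, Set.image_univ, Set.mem_range] at hx hy
      obtain ⟨i, rfl⟩ := hx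
      obtain ⟨j, rfl⟩ := hy
      rw [hF, hF] at hxy
      rw [g.injective hxy])
  refine ⟨e.toEmbedding.trans (Function.Embedding.subtype _), fun i => ?_⟩
  exact (he _ (Finset.mem_map_of_mem _ (Finset.mem_univ _))).trans (hF i)

theorem finite_setOf_boundariedGraph (b m : ℕ) :
    {x : Σ t, BoundariedGraph t | x.1 ≤ b ∧ x.2.n ≤ m}.Finite := by
  let f : (Σ (r : Fin (b + 1)) (n : Fin (m + 1)), SimpleGraph (Fin n) × (Fin r ↪ Fin n)) →
      Σ t, BoundariedGraph t := fun x => ⟨x.1, ⟨⟨x.2.1, x.2.2.1⟩, x.2.2.2⟩⟩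
  refine (Set.finite_range f).subset ?_
  rintro ⟨r, ⟨⟨n, X⟩, term⟩⟩ ⟨hr, hn⟩
  exact ⟨⟨⟨r, Nat.lt_succ_of_le hr⟩, ⟨⟨n, Nat.lt_succ_of_le hn⟩, X, term⟩⟩, rfl⟩

/-- A problem of finite integer index has a finite table of replacements for all boundaried graphs
of moderate size with at most `b` terminals. -/
theorem FiniteIntegerIndex.exists_replacements {P : ParamGraphProblem} {𝒢 : Set FinGraph}
    (h : P.FiniteIntegerIndex 𝒢) (b s₀ : ℕ) :
    ∃ s, s₀ ≤ s ∧ ∃ L : List (Σ x : (Σ t, BoundariedGraph t), Replacement P 𝒢 x.2),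
      ∀ t ≤ b, ∀ A : BoundariedGraph t, A.toFinGraph ∈ 𝒢 → s < A.n → A.n ≤ 2 * s →
        ∃ ρ ∈ L, ρ.1 = ⟨t, A⟩ := by
  classical
  have h1 : ∀ t, ∃ m : ℕ, ∀ A : BoundariedGraph t, A.toFinGraph ∈ 𝒢 →
      ∃ R : BoundariedGraph t, R.n ≤ m ∧ ∃ a, P.ShiftsTo 𝒢 A R a := by
    intro t
    have := h t
    choose R hR using P.exists_progressive_representative 𝒢 t
    obtain ⟨m, hm⟩ := (Set.finite_range fun q => (R q).1.n).bddAbove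
    exact ⟨m, fun A hA => ⟨(R (Quotient.mk _ ⟨A, hA⟩)).1, hm ⟨_, rfl⟩, hR _ ⟨A, hA⟩ rfl⟩⟩
  choose m hm using h1
  -- The sum bounds every representative with at most `b` terminals, so a graph with more than `s`
  -- vertices is strictly larger than its representative.
  refine ⟨s₀ + ∑ t ∈ Finset.range (b + 1), m t, Nat.le_add_right _ _, ?_⟩
  set s := s₀ + ∑ t ∈ Finset.range (b + 1), m t with hs
  have hrep : ∀ x : Σ t, BoundariedGraph t, x.1 ≤ b → x.2.toFinGraph ∈ 𝒢 → s < x.2.n →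
      Nonempty (Replacement P 𝒢 x.2) := by
    rintro ⟨t, A⟩ ht hA hn
    obtain ⟨R, hRm, a, ha⟩ := hm t A hA
    have hmt : m t ≤ ∑ t ∈ Finset.range (b + 1), m t :=
      Finset.single_le_sum (f := m) (fun _ _ => Nat.zero_le _)
        (Finset.mem_range.2 (Nat.lt_succ_of_le ht))
    have hlt : R.n < A.n := by
      simp only at hn
      omega
    obtain ⟨π, hπ⟩ := exists_embedding_extending R.terminal A.terminal hlt
    exact ⟨⟨R, π, hπ, hlt, a, ha⟩⟩
  refine ⟨(finite_setOf_boundariedGraph b (2 * s)).toFinset.toList.filterMap fun x =>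
    if hx : Nonempty (Replacement P 𝒢 x.2) then some ⟨x, hx.some⟩ else none, ?_⟩
  intro t ht A hA hsA hAs
  have hne := hrep ⟨t, A⟩ ht hA hsA
  refine ⟨⟨⟨t, A⟩, hne.some⟩, List.mem_filterMap.2 ⟨⟨t, A⟩, ?_, dif_pos hne⟩, rfl⟩
  rw [Finset.mem_toList, Set.Finite.mem_toFinset]
  exact ⟨ht, hAs⟩

end ParamGraphProblem

/-! ### Replacing a part of a graph -/

/-- The graph induced by `G` on `S`. -/
noncomputable def FinGraph.ofInduced {N : ℕ} (S : Finset (Fin N)) (G : SimpleGraph (Fin N)) :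
    FinGraph :=
  FinGraph.of (G.comap (Subtype.val : {v // v ∈ S} → Fin N))

theorem FinGraph.ofInduced_n {N : ℕ} (S : Finset (Fin N)) (G : SimpleGraph (Fin N)) :
    (FinGraph.ofInduced S G).n = S.card :=
  Fintype.card_coe S

namespace BoundariedGraph

variable {t N : ℕ}

/-- The vertices `w` of the graph induced by `G` on `S` carry a copy of `A`, whose non-terminals
have no further neighbours. -/
structure IsMatch (A : BoundariedGraph t) (S : Finset (Fin N)) (G : SimpleGraph (Fin N))
    (w : Fin A.n → Fin N) : Prop where
  injective : Function.Injective w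
  mem : ∀ i, w i ∈ S
  adj_iff : ∀ i j, G.Adj (w i) (w j) ↔ A.graph.Adj i j
  inner : ∀ i, i ∉ Set.range A.terminal → ∀ v ∈ S, v ∉ Set.range w → ¬ G.Adj (w i) v

end BoundariedGraph

namespace ParamGraphProblem.Replacement

open BoundariedGraph

variable {P : ParamGraphProblem} {𝒢 : Set FinGraph} {t N : ℕ} {A : BoundariedGraph t}

open Classical in
/-- The vertices that remain when the copy `w` of `A` is replaced. -/
noncomputable def newSet (ρ : Replacement P 𝒢 A) (S : Finset (Fin N)) (w : Fin A.n → Fin N) :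
    Finset (Fin N) :=
  S \ ({j | j ∉ Set.range ρ.place} : Finset (Fin A.n)).image w

/-- The edges after the replacement of the copy `w` of `A`. -/
def newGraph (ρ : Replacement P 𝒢 A) (G : SimpleGraph (Fin N)) (w : Fin A.n → Fin N) :
    SimpleGraph (Fin N) where
  Adj u v := u ≠ v ∧ ((∃ a b, w (ρ.place a) = u ∧ w (ρ.place b) = v ∧ ρ.R.graph.Adj a b) ∨
    (G.Adj u v ∧ ¬ ((∃ a, w (ρ.place a) = u) ∧ ∃ b, w (ρ.place b) = v)))
  symm := ⟨by
    rintro u v ⟨hne, ⟨a, b, h1, h2, h3⟩ | ⟨h1, h2⟩⟩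
    · exact ⟨hne.symm, Or.inl ⟨b, a, h2, h1, h3.symm⟩⟩
    · exact ⟨hne.symm, Or.inr ⟨h1.symm, fun h => h2 ⟨h.2, h.1⟩⟩⟩⟩
  loopless := ⟨fun _ h => h.1 rfl⟩

variable {S : Finset (Fin N)} {G : SimpleGraph (Fin N)} {w : Fin A.n → Fin N}

theorem mem_newSet (ρ : Replacement P 𝒢 A) {v : Fin N} :
    v ∈ ρ.newSet S w ↔ v ∈ S ∧ ∀ j, w j = v → j ∈ Set.range ρ.place := by
  classical
  simp only [newSet, Finset.mem_sdiff, Finset.mem_image, Finset.mem_filter, Finset.mem_univ,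
    true_and]
  constructor
  · rintro ⟨h1, h2⟩
    exact ⟨h1, fun j hj => by_contra fun h => h2 ⟨j, h, hj⟩⟩
  · rintro ⟨h1, h2⟩
    exact ⟨h1, fun ⟨j, h, hj⟩ => h (h2 j hj)⟩

theorem card_newSet (ρ : Replacement P 𝒢 A) (h : A.IsMatch S G w) :
    (ρ.newSet S w).card + (A.n - ρ.R.n) = S.card := by
  classical
  have h1 : (({j | j ∉ Set.range ρ.place} : Finset (Fin A.n)).image w).card = A.n - ρ.R.n := by
    rw [Finset.card_image_of_injective _ h.injective]
    have : ({j | j ∉ Set.range ρ.place} : Finset (Fin A.n)) = (Finset.univ.map ρ.place)ᶜ := by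
      ext j; simp
    rw [this, Finset.card_compl, Finset.card_map]
    simp
  rw [newSet, ← h1]
  refine Finset.card_sdiff_add_card_eq_card ?_
  intro v hv
  obtain ⟨j, -, rfl⟩ := Finset.mem_image.1 hv
  exact h.mem j

/-- The rest of the graph, as a boundaried graph whose terminals are those of the copy of `A`. -/
theorem exists_environment (ρ : Replacement P 𝒢 A) (h : A.IsMatch S G w) :
    ∃ C : BoundariedGraph t, Nonempty ((A.glue C).graph ≃g (FinGraph.ofInduced S G).graph) ∧
      Nonempty ((ρ.R.glue C).graph ≃g
        (FinGraph.ofInduced (ρ.newSet S w) (ρ.newGraph G w)).graph) := by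
  classical
  -- The environment keeps the vertices outside the copy and its terminals. It drops all edges with
  -- both ends in the copy, also those between terminals: these belong to `A`, and to `R` after the
  -- replacement.
  let E : Type := {v : Fin N // v ∈ S ∧ ((∀ j, w j ≠ v) ∨ ∃ i, w (A.terminal i) = v)}
  let e : E ≃ Fin (Fintype.card E) := Fintype.equivFin E
  let C : BoundariedGraph t :=
    { n := Fintype.card E
      graph :=
        { Adj := fun x y => G.Adj (e.symm x).1 (e.symm y).1 ∧
            ¬ ((∃ i, w i = (e.symm x).1) ∧ ∃ i, w i = (e.symm y).1)
          symm := ⟨fun x y hxy => ⟨hxy.1.symm, fun hh => hxy.2 ⟨hh.2, hh.1⟩⟩⟩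
          loopless := ⟨fun x hx => hx.1.ne rfl⟩ }
      terminal := ⟨fun i => e ⟨w (A.terminal i), h.mem _, Or.inr ⟨i, rfl⟩⟩, fun i j hij => by
        have := congrArg Subtype.val (e.injective hij)
        exact A.terminal.injective (h.injective this)⟩ }
  have hterm : ∀ i, (e.symm (C.terminal i)).1 = w (A.terminal i) := fun i => by
    change (e.symm (e _)).1 = _
    rw [e.symm_apply_apply]
  have hC : ∀ x y : Fin C.n, C.graph.Adj x y ↔ G.Adj (e.symm x).1 (e.symm y).1 ∧
      ¬ ((∃ i, w i = (e.symm x).1) ∧ ∃ i, w i = (e.symm y).1) := fun _ _ => Iff.rfl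
  have hE : ∀ v ∈ S, (∀ j, w j = v → ∃ i, j = A.terminal i) → ∃ c : Fin C.n, (e.symm c).1 = v := by
    intro v hv hj
    refine ⟨e ⟨v, hv, ?_⟩, by rw [e.symm_apply_apply]⟩
    by_cases hw : ∃ j, w j = v
    · obtain ⟨j, hjv⟩ := hw
      obtain ⟨i, rfl⟩ := hj j hjv
      exact Or.inr ⟨i, hjv⟩
    · exact Or.inl fun j hjv => hw ⟨j, hjv⟩
  refine ⟨C, ?_, ?_⟩
  · refine Nonempty.map (fun f => f.trans (SimpleGraph.overFinIso _ rfl)) <|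
      nonempty_glue_iso A C (G.comap (Subtype.val : {v // v ∈ S} → Fin N))
      (fun a => ⟨w a, h.mem a⟩) (fun c => ⟨(e.symm c).1, (e.symm c).2.1⟩)
      (fun a b hab => h.injective (congrArg Subtype.val hab))
      (fun a b hab => e.symm.injective (Subtype.ext (Subtype.mk.inj hab)))
      (fun i => Subtype.ext (hterm i).symm) ?_ ?_ ?_
    · rintro ⟨v, hv⟩
      by_cases hw : ∃ j, w j = v
      · obtain ⟨j, hj⟩ := hw
        exact Or.inl ⟨j, Subtype.ext hj⟩
      · obtain ⟨c, hc⟩ := hE v hv fun j hj => absurd ⟨j, hj⟩ hw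
        exact Or.inr ⟨c, Subtype.ext hc⟩
    · intro a c hac
      have hac : w a = (e.symm c).1 := congrArg Subtype.val hac
      rcases (e.symm c).2.2 with h1 | ⟨i, h1⟩
      · exact absurd hac (h1 a)
      · exact ⟨i, h.injective (hac.trans h1.symm)⟩
    · rintro ⟨u, hu⟩ ⟨v, hv⟩
      change G.Adj u v ↔ _
      simp only [Subtype.mk.injEq, hC]
      constructor
      · intro huv
        by_cases hw : (∃ i, w i = u) ∧ ∃ i, w i = v
        · obtain ⟨⟨i, rfl⟩, ⟨j, rfl⟩⟩ := hw
          exact Or.inl ⟨i, j, (h.adj_iff i j).1 huv, rfl, rfl⟩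
        · right
          obtain ⟨x, hx⟩ := hE u hu fun j hj => by
            by_contra hne
            refine h.inner j (fun ⟨i, hi⟩ => hne ⟨i, hi.symm⟩) v hv ?_ (hj ▸ huv)
            rintro ⟨i, hi⟩
            exact hw ⟨⟨j, hj⟩, ⟨i, hi⟩⟩
          obtain ⟨y, hy⟩ := hE v hv fun j hj => by
            by_contra hne
            refine h.inner j (fun ⟨i, hi⟩ => hne ⟨i, hi.symm⟩) u hu ?_ (hj ▸ huv.symm)
            rintro ⟨i, hi⟩
            exact hw ⟨⟨i, hi⟩, ⟨j, hj⟩⟩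
          refine ⟨x, y, ?_, hx, hy⟩
          rw [hx, hy]
          exact ⟨huv, hw⟩
      · rintro (⟨a, b, hab, rfl, rfl⟩ | ⟨a, b, hab, rfl, rfl⟩)
        · exact (h.adj_iff a b).2 hab
        · exact hab.1
  · have hin : ∀ c, (e.symm c).1 ∈ ρ.newSet S w := fun c => by
      refine ρ.mem_newSet.2 ⟨(e.symm c).2.1, fun j hj => ?_⟩
      rcases (e.symm c).2.2 with h1 | ⟨i, h1⟩
      · exact absurd hj (h1 j)
      · rw [h.injective (hj.trans h1.symm), ← ρ.place_terminal]
        exact ⟨_, rfl⟩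
    have hin' : ∀ a, w (ρ.place a) ∈ ρ.newSet S w := fun a =>
      ρ.mem_newSet.2 ⟨h.mem _, fun j hj => ⟨a, (h.injective hj).symm⟩⟩
    have hold : ∀ v ∈ ρ.newSet S w, (∃ i, w i = v) → ∃ a, w (ρ.place a) = v := by
      rintro v hv ⟨i, rfl⟩
      obtain ⟨a, ha⟩ := (ρ.mem_newSet.1 hv).2 i rfl
      exact ⟨a, by rw [ha]⟩
    refine Nonempty.map (fun f => f.trans (SimpleGraph.overFinIso _ rfl)) <|
      nonempty_glue_iso ρ.R C
      ((ρ.newGraph G w).comap (Subtype.val : {v // v ∈ ρ.newSet S w} → Fin N))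
      (fun a => ⟨w (ρ.place a), hin' a⟩) (fun c => ⟨(e.symm c).1, hin c⟩)
      (fun a b hab => ρ.place.injective (h.injective (congrArg Subtype.val hab)))
      (fun a b hab => e.symm.injective (Subtype.ext (Subtype.mk.inj hab)))
      (fun i => Subtype.ext (by simp only [ρ.place_terminal, hterm])) ?_ ?_ ?_
    · rintro ⟨v, hv⟩
      by_cases hw : ∃ j, w j = v
      · obtain ⟨a, ha⟩ := hold v hv hw
        exact Or.inl ⟨a, Subtype.ext ha⟩
      · obtain ⟨c, hc⟩ := hE v (ρ.mem_newSet.1 hv).1 fun j hj => absurd ⟨j, hj⟩ hw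
        exact Or.inr ⟨c, Subtype.ext hc⟩
    · intro a c hac
      have hac : w (ρ.place a) = (e.symm c).1 := congrArg Subtype.val hac
      rcases (e.symm c).2.2 with h1 | ⟨i, h1⟩
      · exact absurd hac (h1 _)
      · refine ⟨i, ρ.place.injective ?_⟩
        rw [ρ.place_terminal]
        exact h.injective (hac.trans h1.symm)
    · rintro ⟨u, hu⟩ ⟨v, hv⟩
      change (ρ.newGraph G w).Adj u v ↔ _
      simp only [Subtype.mk.injEq, hC]
      have huS := (ρ.mem_newSet.1 hu).1
      have hvS := (ρ.mem_newSet.1 hv).1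
      constructor
      · rintro ⟨-, ⟨a, b, h1, h2, h3⟩ | ⟨huv, hn⟩⟩
        · exact Or.inl ⟨a, b, h3, h1, h2⟩
        · right
          have hw : ¬ ((∃ i, w i = u) ∧ ∃ i, w i = v) := fun hw =>
            hn ⟨hold u hu hw.1, hold v hv hw.2⟩
          obtain ⟨x, hx⟩ := hE u huS fun j hj => by
            by_contra hne
            refine h.inner j (fun ⟨i, hi⟩ => hne ⟨i, hi.symm⟩) v hvS ?_ (hj ▸ huv)
            rintro ⟨i, hi⟩
            exact hw ⟨⟨j, hj⟩, ⟨i, hi⟩⟩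
          obtain ⟨y, hy⟩ := hE v hvS fun j hj => by
            by_contra hne
            refine h.inner j (fun ⟨i, hi⟩ => hne ⟨i, hi.symm⟩) u huS ?_ (hj ▸ huv.symm)
            rintro ⟨i, hi⟩
            exact hw ⟨⟨i, hi⟩, ⟨j, hj⟩⟩
          refine ⟨x, y, ?_, hx, hy⟩
          rw [hx, hy]
          exact ⟨huv, hw⟩
      · rintro (⟨a, b, hab, rfl, rfl⟩ | ⟨a, b, hab, rfl, rfl⟩)
        · exact ⟨fun heq => hab.ne (ρ.place.injective (h.injective heq)),
            Or.inl ⟨a, b, rfl, rfl, hab⟩⟩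
        · exact ⟨hab.1.ne, Or.inr ⟨hab.1, fun hij =>
            hab.2 ⟨hij.1.elim fun i hi => ⟨_, hi⟩, hij.2.elim fun j hj => ⟨_, hj⟩⟩⟩⟩

/-- The old and the new graph are gluings of `A` and of `R` with the same environment, so `shiftsTo`
compares them, for membership in the class as well as for the answers. -/
theorem newGraph_mem_and_iff (ρ : Replacement P 𝒢 A)
    (h𝒢 : ∀ G H : FinGraph, Nonempty (G.graph ≃g H.graph) → G ∈ 𝒢 → H ∈ 𝒢)
    (h : A.IsMatch S G w) (hG : FinGraph.ofInduced S G ∈ 𝒢) :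
    FinGraph.ofInduced (ρ.newSet S w) (ρ.newGraph G w) ∈ 𝒢 ∧
      ∀ k : ℤ, P.Mem (FinGraph.ofInduced S G) k ↔
        P.Mem (FinGraph.ofInduced (ρ.newSet S w) (ρ.newGraph G w)) (k - ρ.shift) := by
  obtain ⟨C, ⟨f⟩, ⟨g⟩⟩ := ρ.exists_environment h
  obtain ⟨h1, h2⟩ := ρ.shiftsTo C
  have hA := h𝒢 _ _ ⟨f.symm⟩ hG
  exact ⟨h𝒢 _ _ ⟨g⟩ (h1.1 hA), fun k =>
    (P.iso_invariant _ _ k ⟨f⟩).symm.trans ((h2 hA k).trans (P.iso_invariant _ _ _ ⟨g⟩))⟩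

end ParamGraphProblem.Replacement

/-! ### Bounded degree -/

theorem mem_boundedDegreeClass_of_embedding {d : ℕ} {G H : FinGraph}
    (f : H.graph ↪g G.graph) (hG : G ∈ boundedDegreeClass d) : H ∈ boundedDegreeClass d := by
  classical
  have hG' : G.graph.maxDegree ≤ d := by
    have h : _ ≤ d := hG
    convert h
  have h : H.graph.maxDegree ≤ d := (SimpleGraph.Copy.maxDegree_mono f.toCopy).trans hG'
  change _ ≤ d
  convert h

theorem FinGraph.size_le_of_mem_boundedDegreeClass {d : ℕ} {G : FinGraph}
    (hG : G ∈ boundedDegreeClass d) : G.size ≤ G.n * (d + 1) := by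
  classical
  have hG' : G.graph.maxDegree ≤ d := by
    have h : _ ≤ d := hG
    convert h
  have h1 : G.graph.edgeSet.ncard = G.graph.edgeFinset.card := by
    rw [← SimpleGraph.coe_edgeFinset, Set.ncard_coe_finset]
  have h2 := G.graph.sum_degrees_eq_twice_card_edges
  have h3 : ∑ v, G.graph.degree v ≤ G.n * d := by
    have := Finset.sum_le_card_nsmul Finset.univ (fun v => G.graph.degree v) d
      fun v _ => (G.graph.degree_le_maxDegree v).trans hG'
    simpa using this
  rw [FinGraph.size, h1, Nat.mul_add, Nat.mul_one]
  omega

open BoundariedGraph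

/-- Every set of vertices of a graph carries a boundaried graph, whose terminals are the vertices
with neighbours outside the set. -/
theorem exists_isMatch {d N : ℕ} {S : Finset (Fin N)} {G : SimpleGraph (Fin N)}
    (hG : FinGraph.ofInduced S G ∈ boundedDegreeClass d)
    (W : Finset (Fin (FinGraph.ofInduced S G).n)) :
    ∃ A : BoundariedGraph ((FinGraph.ofInduced S G).graph.boundary W).card,
      A.n = W.card ∧ A.toFinGraph ∈ boundedDegreeClass d ∧
        ∃ w : Fin A.n → Fin N, A.IsMatch S G w := by
  classical
  let H : FinGraph := FinGraph.ofInduced S G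
  let φ : G.comap (Subtype.val : {v // v ∈ S} → Fin N) ≃g H.graph := SimpleGraph.overFinIso _ rfl
  let e : Fin W.card ≃ W := W.equivFin.symm
  let τ := (H.graph.boundary W).equivFin.symm
  have hW : ∀ i, (τ i).1 ∈ W := fun i => (SimpleGraph.mem_boundary.1 (τ i).2).1
  let A : BoundariedGraph (H.graph.boundary W).card :=
    { n := W.card
      graph := H.graph.comap fun i => (e i).1
      terminal := ⟨fun i => e.symm ⟨(τ i).1, hW i⟩, fun i j hij => by
        have := congrArg Subtype.val (e.symm.injective hij)
        exact τ.injective (Subtype.ext this)⟩ }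
  have hadj : ∀ x y : Fin H.n, G.Adj (φ.symm x).1 (φ.symm y).1 ↔ H.graph.Adj x y := fun x y =>
    φ.symm.map_rel_iff
  refine ⟨A, rfl, mem_boundedDegreeClass_of_embedding
    (SimpleGraph.Embedding.comap (e.toEmbedding.trans (Function.Embedding.subtype _)) H.graph) hG,
    fun i => (φ.symm (e i).1).1, ?_⟩
  refine ⟨fun i j hij => e.injective (Subtype.ext (φ.symm.injective (Subtype.ext hij))),
    fun i => (φ.symm (e i).1).2, fun i j => hadj _ _, fun i hi v hv hvw hadj' => hi ?_⟩
  have hvφ : (φ.symm (φ ⟨v, hv⟩)).1 = v := by rw [φ.symm_apply_apply]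
  have hvW : φ ⟨v, hv⟩ ∉ W := fun h => hvw ⟨e.symm ⟨_, h⟩, by
    simp only [Equiv.apply_symm_apply]
    exact hvφ⟩
  have hb : (e i).1 ∈ H.graph.boundary W :=
    SimpleGraph.mem_boundary.2 ⟨(e i).2, _, hvW, (hadj _ _).1 (by rwa [hvφ])⟩
  refine ⟨τ.symm ⟨_, hb⟩, e.injective ?_⟩
  change e (e.symm _) = e i
  rw [e.apply_symm_apply]
  exact Subtype.ext (by simp)

/-- A large yes-instance contains a piece of moderate size with a small boundary. -/
theorem exists_isMatch_of_mem {P : ParamGraphProblem} {d c t s N k : ℕ}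
    (htw : ∀ G ∈ boundedDegreeClass d, ∀ k : ℕ, P.Mem G k →
      ∃ X : Finset (Fin G.n), X.card ≤ c * k ∧ TreewidthLE (G.graph.induce {v | v ∉ X}) t)
    (hts : t + 1 ≤ s) {S : Finset (Fin N)} {G : SimpleGraph (Fin N)}
    (hG : FinGraph.ofInduced S G ∈ boundedDegreeClass d) (hk : P.Mem (FinGraph.ofInduced S G) k)
    (hS : 2 * s * (c * k * d) + s + c * k < S.card) :
    ∃ r ≤ t + 1 + (t + 1) * d + 1, ∃ A : BoundariedGraph r,
      A.toFinGraph ∈ boundedDegreeClass d ∧ s < A.n ∧ A.n ≤ 2 * s ∧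
        ∃ w : Fin A.n → Fin N, A.IsMatch S G w := by
  classical
  obtain ⟨X, hX, hXt⟩ := htw _ hG k hk
  obtain ⟨W, h1, h2, h3⟩ := SimpleGraph.exists_piece_of_treewidth_deletion (d := d) (s := s)
    (by have h : _ ≤ d := hG
        convert h) hts X hXt (by
    have h4 : 2 * s * (X.card * d) ≤ 2 * s * (c * k * d) :=
      Nat.mul_le_mul_left _ (Nat.mul_le_mul_right _ hX)
    have h5 := FinGraph.ofInduced_n S G
    rw [Fintype.card_fin]
    omega)
  obtain ⟨A, hA, hAd, w, hw⟩ := exists_isMatch hG W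
  exact ⟨_, h3, A, hAd, by omega, by omega, w, hw⟩

/-! ### Running programs -/

namespace RAM

@[simp] theorem State.arr_setVar (σ : State) (x v : ℕ) : (σ.setVar x v).arr = σ.arr := rfl

@[simp] theorem State.var_setVar_self (σ : State) (x v : ℕ) : (σ.setVar x v).var x = v :=
  if_pos rfl

theorem State.var_setVar_of_ne (σ : State) {x y : ℕ} (v : ℕ) (h : y ≠ x) :
    (σ.setVar x v).var y = σ.var y := if_neg h

@[simp] theorem State.setVar_self (σ : State) (x : ℕ) : σ.setVar x (σ.var x) = σ := by
  cases σ
  simp only [State.setVar, State.mk.injEq, and_true]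
  funext y
  split_ifs with h
  · rw [h]
  · rfl

/-- Started in `σ`, the program `p` halts after at most `T` steps, in a state that satisfies
`Q`. -/
def Runs (p : Prog) (σ : State) (T : ℕ) (Q : State → Prop) : Prop :=
  ∃ τ T', Exec p σ τ T' ∧ T' ≤ T ∧ Q τ

namespace Runs

variable {p q : Prog} {σ : State} {S T : ℕ} {Q R : State → Prop} {e : Expr}

theorem mono (h : Runs p σ S R) (hST : S ≤ T) (hRQ : ∀ τ, R τ → Q τ) : Runs p σ T Q := by
  obtain ⟨τ, T', h1, h2, h3⟩ := h
  exact ⟨τ, T', h1, h2.trans hST, hRQ τ h3⟩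

theorem seq (h : Runs p σ S R) (hq : ∀ τ, R τ → Runs q τ T Q) :
    Runs (.seq p q) σ (S + T + 1) Q := by
  obtain ⟨τ, T₁, h1, h2, h3⟩ := h
  obtain ⟨υ, T₂, h4, h5, h6⟩ := hq τ h3
  exact ⟨υ, _, .seq _ _ _ _ _ _ _ h1 h4, by omega, h6⟩

theorem assign {x : ℕ} (h : Q (σ.setVar x (e.eval σ))) : Runs (.assign x e) σ (e.cost + 1) Q :=
  ⟨_, _, .assign _ _ _, le_rfl, h⟩

theorem write {a : ℕ} {i j : Expr} (h : Q (σ.setArr a (i.eval σ) (j.eval σ) (e.eval σ))) :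
    Runs (.write a i j e) σ (i.cost + j.cost + e.cost + 1) Q :=
  ⟨_, _, .write _ _ _ _ _, le_rfl, h⟩

theorem ite (hp : e.eval σ ≠ 0 → Runs p σ S Q) (hq : e.eval σ = 0 → Runs q σ T Q) :
    Runs (.ite e p q) σ (e.cost + (S + T) + 1) Q := by
  by_cases h : e.eval σ = 0
  · obtain ⟨τ, T', h1, h2, h3⟩ := hq h
    exact ⟨τ, _, .ite_false _ _ _ _ _ _ h h1, by omega, h3⟩
  · obtain ⟨τ, T', h1, h2, h3⟩ := hp h
    exact ⟨τ, _, .ite_true _ _ _ _ _ _ h h1, by omega, h3⟩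

/-- Total correctness of loops: `I` is an invariant and `μ` decreases. -/
theorem whileLoop (I : State → Prop) (μ : State → ℕ)
    (hstep : ∀ σ, I σ → e.eval σ ≠ 0 → Runs p σ T fun τ => I τ ∧ μ τ < μ σ)
    (hpost : ∀ σ, I σ → e.eval σ = 0 → Q σ) {m : ℕ} (hI : I σ) (hm : μ σ ≤ m) :
    Runs (.while e p) σ (m * (e.cost + T + 1) + e.cost + 1) Q := by
  induction m generalizing σ with
  | zero =>
    by_cases h : e.eval σ = 0
    · exact ⟨σ, _, .while_done _ _ _ h, by omega, hpost σ hI h⟩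
    · obtain ⟨τ, T', -, -, -, h4⟩ := hstep σ hI h
      omega
  | succ m ih =>
    by_cases h : e.eval σ = 0
    · exact ⟨σ, _, .while_done _ _ _ h, by rw [add_assoc]; exact Nat.le_add_left _ _, hpost σ hI h⟩
    · obtain ⟨τ, T₁, h1, h2, h3, h4⟩ := hstep σ hI h
      obtain ⟨υ, T₂, h5, h6, h7⟩ := ih h3 (by omega)
      refine ⟨υ, _, .while_step _ _ _ _ _ _ _ h h1 h5, ?_, h7⟩
      rw [Nat.add_mul]
      omega

end Runs

/-! ### Derived program constructs and their running times -/

namespace Prog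

/-- The program that does nothing. -/
def skip : Prog := .assign 0 (.var 0)

/-- `for x < b do p`, where `b` is a variable. -/
def forLoop (x b : ℕ) (p : Prog) : Prog :=
  .seq (.assign x (.const 0))
    (.while (.sub (.var b) (.var x)) (.seq p (.assign x (.add (.var x) (.const 1)))))

/-- Write constants to a list of cells of the array `a`. -/
def writes (a : ℕ) : List (Expr × Expr × ℕ) → Prog
  | [] => skip
  | e :: l => .seq (.write a e.1 e.2.1 (.const e.2.2)) (writes a l)

def writesCost : List (Expr × Expr × ℕ) → ℕ
  | [] => 2
  | e :: l => e.1.cost + e.2.1.cost + 2 + writesCost l + 1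

/-- Fill the part `[0, b) × [0, b)` of the array `a`. -/
def fill (a x y b : ℕ) (e : Expr) : Prog :=
  forLoop x b (forLoop y b (.write a (.var x) (.var y) e))

end Prog

namespace Runs

variable {p q : Prog} {σ : State} {S T : ℕ} {Q R : State → Prop} {e : Expr}

theorem skip (h : Q σ) : Runs Prog.skip σ 2 Q := by
  refine Runs.assign (e := .var 0) ?_
  rwa [Expr.eval, State.setVar_self]

/-- `I i` holds when the loop starts its `i`-th iteration. -/
theorem forLoop {x b n : ℕ} (I : ℕ → State → Prop) (hx : ∀ i σ, I i σ → σ.var x = i)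
    (hb : ∀ i σ, I i σ → σ.var b = n) (hinit : I 0 (σ.setVar x 0))
    (hstep : ∀ i σ, i < n → I i σ → Runs p σ T fun τ => τ.var x = i ∧ I (i + 1) (τ.setVar x (i + 1)))
    (hpost : ∀ σ, I n σ → Q σ) : Runs (Prog.forLoop x b p) σ (n * (T + 9) + 7) Q := by
  have h : Runs (.while (.sub (.var b) (.var x)) (.seq p (.assign x (.add (.var x) (.const 1)))))
      (σ.setVar x 0) (n * (3 + (T + 4 + 1) + 1) + 3 + 1) Q := by
    refine Runs.whileLoop (e := .sub (.var b) (.var x)) (fun τ => ∃ i, i ≤ n ∧ I i τ)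
      (fun τ => n - τ.var x) ?_ ?_ ⟨0, Nat.zero_le _, hinit⟩ (Nat.sub_le _ _)
    · rintro τ ⟨i, hin, hI⟩ hne
      simp only [Expr.eval, hx i τ hI, hb i τ hI] at hne
      refine Runs.seq (hstep i τ (by omega) hI) fun υ hυ => Runs.assign ?_
      simp only [Expr.eval, hυ.1]
      refine ⟨⟨i + 1, by omega, hυ.2⟩, ?_⟩
      rw [State.var_setVar_self, hx i τ hI]
      omega
    · rintro τ ⟨i, hin, hI⟩ h0
      simp only [Expr.eval, hx i τ hI, hb i τ hI] at h0
      have : i = n := by omega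
      exact hpost τ (this ▸ hI)
  refine (Runs.seq (Runs.assign (Q := fun τ => τ = σ.setVar x 0) rfl)
    fun τ (hτ : τ = _) => hτ ▸ h).mono ?_ fun _ h => h
  simp only [Expr.cost]
  have : 3 + (T + 4 + 1) + 1 = T + 9 := by omega
  rw [this]
  omega

/-- The result of a sequence of writes, when the addresses depend on variables only. -/
theorem writes {a : ℕ} (f : ℕ → ℕ → ℕ) (l : List (Expr × Expr × ℕ))
    (hl : ∀ e ∈ l, ∀ σ τ : State, σ.var = τ.var →
      e.1.eval σ = e.1.eval τ ∧ e.2.1.eval σ = e.2.1.eval τ)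
    (hf : ∀ e ∈ l, f (e.1.eval σ) (e.2.1.eval σ) = e.2.2)
    (hσ : ∀ i j, (∀ e ∈ l, ¬ (e.1.eval σ = i ∧ e.2.1.eval σ = j)) → σ.arr a i j = f i j) :
    Runs (Prog.writes a l) σ (Prog.writesCost l)
      fun τ => τ = { σ with arr := fun b => if b = a then f else σ.arr b } := by
  induction l generalizing σ with
  | nil =>
    refine Runs.skip ?_
    cases σ
    simp only [State.mk.injEq, true_and]
    funext b
    split_ifs with hb
    · subst hb
      funext i j
      exact hσ i j (by simp)
    · rfl
  | cons e l ih =>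
    refine Runs.seq (T := Prog.writesCost l) (Runs.write (Q := fun τ =>
      τ = σ.setArr a (e.1.eval σ) (e.2.1.eval σ) e.2.2) rfl) fun τ hτ => ?_
    have hvar : τ.var = σ.var := by rw [hτ]; rfl
    have hev : ∀ e' ∈ l, e'.1.eval τ = e'.1.eval σ ∧ e'.2.1.eval τ = e'.2.1.eval σ :=
      fun e' he' => hl e' (List.mem_cons_of_mem _ he') _ _ hvar
    refine (ih (σ := τ) (fun e' he' => hl e' (List.mem_cons_of_mem _ he')) (fun e' he' => ?_)
      (fun i j hij => ?_)).mono le_rfl fun υ hυ => ?_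
    · rw [(hev e' he').1, (hev e' he').2]
      exact hf e' (List.mem_cons_of_mem _ he')
    · by_cases hadr : e.1.eval σ = i ∧ e.2.1.eval σ = j
      · rw [hτ, ← hadr.1, ← hadr.2, hf e List.mem_cons_self]
        exact if_pos ⟨rfl, rfl, rfl⟩
      · have : τ.arr a i j = σ.arr a i j := by
          rw [hτ]
          simp only [State.setArr]
          rw [if_neg]
          rintro ⟨-, h1, h2⟩
          exact hadr ⟨h1.symm, h2.symm⟩
        rw [this]
        refine hσ i j fun e' he' => ?_
        rcases List.mem_cons.1 he' with rfl | he'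
        · exact hadr
        · rw [← (hev e' he').1, ← (hev e' he').2]
          exact hij e' he'
    · rw [hυ, hvar]
      congr 1
      funext b
      split_ifs with hb
      · rfl
      · rw [hτ]
        funext i j
        simp only [State.setArr]
        rw [if_neg]
        exact fun h => hb h.1

/-- The result of filling a square part of the array `a` with values that do not depend on
this array. -/
theorem fill {a x y b n : ℕ} (hxy : x ≠ y) (hbx : b ≠ x) (hby : b ≠ y) (f : ℕ → ℕ → ℕ)
    (hb : σ.var b = n)
    (he : ∀ τ : State, (∀ z, z ≠ x → z ≠ y → τ.var z = σ.var z) →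
      (∀ c, c ≠ a → τ.arr c = σ.arr c) → τ.var x < n → τ.var y < n →
      e.eval τ = f (τ.var x) (τ.var y)) :
    Runs (Prog.fill a x y b e) σ (n * (n * (e.cost + 12) + 16) + 7) fun τ =>
      (∀ z, z ≠ x → z ≠ y → τ.var z = σ.var z) ∧ (∀ c, c ≠ a → τ.arr c = σ.arr c) ∧
      ∀ i j, i < n → j < n → τ.arr a i j = f i j := by
  have hkeep : ∀ (τ : State) (z v : ℕ), (z = x ∨ z = y) →
      (∀ z, z ≠ x → z ≠ y → τ.var z = σ.var z) →
      ∀ u, u ≠ x → u ≠ y → (τ.setVar z v).var u = σ.var u := by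
    rintro τ z v hz h u hux huy
    rw [State.var_setVar_of_ne _ _ (by rcases hz with rfl | rfl <;> assumption), h u hux huy]
  refine (Runs.forLoop (T := n * (e.cost + 12) + 7) (n := n)
    (fun i τ => τ.var x = i ∧ (∀ z, z ≠ x → z ≠ y → τ.var z = σ.var z) ∧
    (∀ c, c ≠ a → τ.arr c = σ.arr c) ∧ ∀ i' j, i' < i → j < n → τ.arr a i' j = f i' j)
    (fun i τ h => h.1) (fun i τ h => (h.2.1 b hbx hby).trans hb)
    ⟨State.var_setVar_self _ _ _, hkeep σ x 0 (Or.inl rfl) fun _ _ _ => rfl, fun _ _ => rfl,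
      fun i' j h => absurd h (Nat.not_lt_zero _)⟩ ?_ fun τ h => h.2).mono ?_ fun _ h => h
  · rintro i τ hi ⟨h1, h2, h3, h4⟩
    refine (Runs.forLoop (T := e.cost + 3) (n := n)
      (fun j υ => υ.var y = j ∧ υ.var x = i ∧ (∀ z, z ≠ x → z ≠ y → υ.var z = σ.var z) ∧
      (∀ c, c ≠ a → υ.arr c = σ.arr c) ∧ (∀ i' j', i' < i → j' < n → υ.arr a i' j' = f i' j') ∧
      ∀ j', j' < j → υ.arr a i j' = f i j')
      (fun j υ h => h.1) (fun j υ h => (h.2.2.1 b hbx hby).trans hb)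
      ⟨State.var_setVar_self _ _ _, (State.var_setVar_of_ne _ _ hxy).trans h1,
        hkeep τ y 0 (Or.inr rfl) h2, h3, h4, fun j' h => absurd h (Nat.not_lt_zero _)⟩ ?_
      (Q := fun υ => υ.var x = i ∧ _) fun υ h => ⟨h.2.1, State.var_setVar_self _ _ _,
        hkeep υ x _ (Or.inl rfl) h.2.2.1, h.2.2.2.1, fun i' j' hi' hj' => ?_⟩).mono ?_ fun _ h => h
    · rintro j υ hj ⟨g1, g2, g3, g4, g5, g6⟩
      refine (Runs.write ?_).mono (by simp only [Expr.cost]; omega) fun _ h => h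
      have hev : e.eval υ = f i j := by
        rw [he υ g3 g4 (g2.trans_lt hi) (g1.trans_lt hj), g1, g2]
      simp only [Expr.eval, g1, g2, hev]
      refine ⟨g1, State.var_setVar_self _ _ _, (State.var_setVar_of_ne _ _ hxy).trans g2,
        hkeep _ y _ (Or.inr rfl) g3, fun c hc => ?_, fun i' j' hi' hj' => ?_, fun j' hj' => ?_⟩
      · rw [← g4 c hc]
        funext r s
        exact if_neg fun h => hc h.1
      · rw [← g5 i' j' hi' hj']
        exact if_neg fun h => hi'.ne h.2.1
      · rcases Nat.lt_succ_iff_lt_or_eq.1 hj' with hlt | rfl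
        · rw [← g6 j' hlt]
          exact if_neg fun h => hlt.ne h.2.2
        · exact if_pos ⟨rfl, rfl, rfl⟩
    · have : e.cost + 3 + 9 = e.cost + 12 := by omega
      rw [this]
    · rcases Nat.lt_succ_iff_lt_or_eq.1 hi' with hlt | rfl
      · exact h.2.2.2.2.1 i' j' hlt hj'
      · exact h.2.2.2.2.2 j' hj'
  · have : n * (e.cost + 12) + 7 + 9 = n * (e.cost + 12) + 16 := by omega
    rw [this]

end Runs

/-! ### Tests as expressions with truncated subtraction -/

namespace Expr

/-- The sum of a finite family of expressions. -/
noncomputable def sum {ι : Type} [Fintype ι] (f : ι → Expr) : Expr :=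
  (Finset.univ.toList.map f).foldr Expr.add (Expr.const 0)

theorem eval_sum_eq_zero {ι : Type} [Fintype ι] (f : ι → Expr) (σ : State) :
    (sum f).eval σ = 0 ↔ ∀ i, (f i).eval σ = 0 := by
  have h : ∀ l : List Expr, (l.foldr Expr.add (Expr.const 0)).eval σ = 0 ↔ ∀ e ∈ l, e.eval σ = 0 := by
    intro l
    induction l with
    | nil => simp [eval]
    | cons e l ih => simp [eval, ih]
  rw [sum, h]
  simp

/-- Test for equality. -/
def eqTest (e f : Expr) : Expr := .sub (.const 1) (.add (.sub e f) (.sub f e))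

theorem eval_eqTest (e f : Expr) (σ : State) :
    (eqTest e f).eval σ = 0 ↔ e.eval σ ≠ f.eval σ := by
  simp only [eqTest, eval]
  omega

/-- The product with a constant. -/
def smul (e : Expr) : ℕ → Expr
  | 0 => .const 0
  | c + 1 => .add (smul e c) e

theorem eval_smul (e : Expr) (c : ℕ) (σ : State) : (smul e c).eval σ = c * e.eval σ := by
  induction c with
  | zero => simp [smul, eval]
  | succ c ih => rw [smul, eval, ih, Nat.add_mul, Nat.one_mul]

end Expr

end RAM

/-! ### The program for one replacement rule -/

namespace RAM

/-- A reduced instance: the graph induced by `G` on the vertices `S` that are still alive, and the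
total amount `sh` by which the parameter has dropped. -/
structure Config (N : ℕ) where
  S : Finset (Fin N)
  G : SimpleGraph (Fin N)
  sh : ℕ

open Classical in
/-- The memory holds the reduced instance `c`: the original instance is in `x₀` and `x₁`, the number
of living vertices in `x₂`, the drop of the parameter in `x₃`, the adjacency matrix in `A₀` and the
marks of the deleted vertices in `A₂`. -/
structure Represents {N : ℕ} (k : ℕ) (σ : State) (c : Config N) : Prop where
  var_zero : σ.var 0 = N
  var_one : σ.var 1 = k
  var_two : σ.var 2 = c.S.card
  var_three : σ.var 3 = c.sh
  dead : ∀ v : Fin N, σ.arr 2 v 0 = if v ∈ c.S then 0 else 1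
  adj : ∀ u ∈ c.S, ∀ v ∈ c.S, σ.arr 0 u v = if c.G.Adj u v then 1 else 0
  le_one : ∀ u v : Fin N, σ.arr 0 u v ≤ 1

theorem Represents.setVar {N k : ℕ} {σ : State} {c : Config N} (h : Represents k σ c) {x : ℕ}
    (hx : 4 ≤ x) (v : ℕ) : Represents k (σ.setVar x v) c where
  var_zero := (State.var_setVar_of_ne _ _ (by omega)).trans h.var_zero
  var_one := (State.var_setVar_of_ne _ _ (by omega)).trans h.var_one
  var_two := (State.var_setVar_of_ne _ _ (by omega)).trans h.var_two
  var_three := (State.var_setVar_of_ne _ _ (by omega)).trans h.var_three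
  dead := h.dead
  adj := h.adj
  le_one := h.le_one

theorem Represents.dead_eq_zero_iff {N k : ℕ} {σ : State} {c : Config N} (h : Represents k σ c)
    (v : Fin N) : σ.arr 2 v 0 = 0 ↔ v ∈ c.S := by
  rw [h.dead]; split_ifs with hv <;> simp [hv]

theorem Represents.adj_eq_zero_iff {N k : ℕ} {σ : State} {c : Config N} (h : Represents k σ c)
    {u v : Fin N} (hu : u ∈ c.S) (hv : v ∈ c.S) : σ.arr 0 u v = 0 ↔ ¬ c.G.Adj u v := by
  rw [h.adj u hu v hv]; split_ifs with huv <;> simp [huv]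

end RAM

namespace BoundariedGraph

open RAM

variable {t : ℕ}

/-- The variable that holds the `i`-th vertex of the current tuple. -/
abbrev tupleVar (i : ℕ) : Expr := .var (10 + i)

open Classical in
/-- This vanishes when the current tuple carries a copy of `A`. -/
noncomputable def copyError (A : BoundariedGraph t) : Expr :=
  .add (Expr.sum fun i : Fin A.n => .add (.sub (.add (tupleVar i) (.const 1)) (.var 0))
      (.read 2 (tupleVar i) (.const 0)))
    (Expr.sum fun p : Fin A.n × Fin A.n => .add
      (if p.1 = p.2 then .const 0 else Expr.eqTest (tupleVar p.1) (tupleVar p.2))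
      (.add (.sub (.read 0 (tupleVar p.1) (tupleVar p.2))
          (.const (if A.graph.Adj p.1 p.2 then 1 else 0)))
        (.sub (.const (if A.graph.Adj p.1 p.2 then 1 else 0))
          (.read 0 (tupleVar p.1) (tupleVar p.2)))))

open Classical in
/-- This vanishes when the vertex in `x₅` is not a further neighbour of a non-terminal. -/
noncomputable def innerError (A : BoundariedGraph t) : Expr :=
  Expr.sum fun i : Fin A.n => if i ∈ Set.range A.terminal then .const 0 else
    .sub (.read 0 (tupleVar i) (.var 5)) (.add (.read 2 (.var 5) (.const 0))
      (Expr.sum fun j : Fin A.n => Expr.eqTest (.var 5) (tupleVar j)))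

/-- A sum of natural numbers vanishes only if every term does. The terms express in turn that each
entry is a vertex, that it is alive, that entries are distinct, and that adjacencies agree (both
truncated differences vanish). -/
theorem eval_copyError (A : BoundariedGraph t) {N k : ℕ} {σ : State} {c : Config N}
    (h : Represents k σ c) : A.copyError.eval σ = 0 ↔
      ∃ w : Fin A.n → Fin N, (∀ i : Fin A.n, σ.var (10 + i) = w i) ∧ Function.Injective w ∧
        (∀ i, w i ∈ c.S) ∧ ∀ i j, c.G.Adj (w i) (w j) ↔ A.graph.Adj i j := by
  classical
  simp only [copyError, Expr.eval, Nat.add_eq_zero_iff, Expr.eval_sum_eq_zero, h.var_zero]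
  constructor
  · rintro ⟨h1, h2⟩
    have hlt : ∀ i : Fin A.n, σ.var (10 + i) < N := fun i => by have := (h1 i).1; omega
    have hS : ∀ i : Fin A.n, (⟨σ.var (10 + i), hlt i⟩ : Fin N) ∈ c.S := fun i =>
      (h.dead_eq_zero_iff _).1 (h1 i).2
    refine ⟨fun i => ⟨σ.var (10 + i), hlt i⟩, fun i => rfl, fun i j hij => ?_, hS,
      fun i j => ?_⟩
    · by_contra hne
      have := (h2 (i, j)).1
      rw [if_neg hne, Expr.eval_eqTest] at this
      exact this (congrArg Fin.val hij)
    · have h3 := (h2 (i, j)).2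
      have h4 := h.adj_eq_zero_iff (hS i) (hS j)
      have h5 := h.adj _ (hS i) _ (hS j)
      simp only at h3 h4 h5
      by_cases hA : A.graph.Adj i j
      · simp only [hA, if_true] at h3
        simp only [hA, iff_true]
        by_contra hn
        rw [h4.2 hn] at h3
        omega
      · simp only [hA, if_false] at h3
        simp only [hA, iff_false]
        exact h4.1 (by omega)
  · rintro ⟨w, hw, hinj, hS, hadj⟩
    simp only [hw]
    refine ⟨fun i => ⟨by have := (w i).2; omega, (h.dead_eq_zero_iff _).2 (hS i)⟩, fun p => ?_⟩
    refine ⟨?_, ?_⟩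
    · split_ifs with hp
      · rfl
      · rw [Expr.eval_eqTest]
        simp only [Expr.eval, hw]
        exact fun heq => hp (hinj (Fin.ext heq))
    · rw [h.adj _ (hS _) _ (hS _)]
      simp only [hadj]
      omega

/-- A matrix entry is at most `1`, even in rows of deleted vertices. Subtracting a positive amount,
from a deletion mark or a coincidence with the tuple, therefore excuses the vertex. -/
theorem eval_innerError (A : BoundariedGraph t) {N k : ℕ} {σ : State} {c : Config N}
    (h : Represents k σ c) (w : Fin A.n → Fin N) (hw : ∀ i : Fin A.n, σ.var (10 + i) = w i)
    (hS : ∀ i, w i ∈ c.S) (v : Fin N) (hv : σ.var 5 = v) : A.innerError.eval σ = 0 ↔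
      ∀ i, i ∉ Set.range A.terminal → v ∈ c.S → v ∉ Set.range w → ¬ c.G.Adj (w i) v := by
  classical
  simp only [innerError, Expr.eval_sum_eq_zero]
  refine forall_congr' fun i => ?_
  split_ifs with hi
  · simp [hi, Expr.eval]
  · simp only [hi, not_false_iff, forall_const, Expr.eval, hw, hv]
    have h1 := h.le_one (w i) v
    have h2 := h.dead v
    have h3 := Expr.eval_sum_eq_zero
      (fun j : Fin A.n => Expr.eqTest (.var 5) (tupleVar j)) σ
    have h4 : (∀ j : Fin A.n, (Expr.eqTest (.var 5) (tupleVar j)).eval σ = 0) ↔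
        v ∉ Set.range w := by
      simp only [Expr.eval_eqTest, Expr.eval, hw, hv, Set.mem_range, not_exists]
      exact forall_congr' fun j => ⟨fun h e => h (congrArg Fin.val e).symm,
        fun h e => h (Fin.ext e.symm)⟩
    rw [h4] at h3
    by_cases hvS : v ∈ c.S
    · rw [if_pos hvS] at h2
      have h5 := h.adj_eq_zero_iff (hS i) hvS
      by_cases hvw : v ∈ Set.range w
      · have : ¬ _ = 0 := fun e => (h3.1 e) hvw
        simp only [hvS, hvw, not_true_eq_false, forall_const, false_imp_iff, iff_true]
        omega
      · have := h3.2 hvw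
        simp only [hvS, hvw, not_false_iff, forall_const, ← h5]
        omega
    · rw [if_neg hvS] at h2
      simp only [hvS, false_imp_iff, iff_true]
      omega

/-- Compute in `x₄` a number that vanishes when the current tuple matches `A`. -/
noncomputable def scan (A : BoundariedGraph t) : Prog :=
  .seq (.assign 4 A.copyError)
    (Prog.forLoop 5 0 (.assign 4 (.add (.var 4) A.innerError)))

/-- The tuple `u` matches `A` in the reduced instance `c`. -/
def Matches (A : BoundariedGraph t) {N : ℕ} (c : Config N) (u : ℕ → ℕ) : Prop :=
  ∃ w : Fin A.n → Fin N, (∀ i : Fin A.n, u i = w i) ∧ A.IsMatch c.S c.G w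

/-- The errors accumulate in `x₄`, which can only grow. It stays `0` exactly if the tuple is a copy
and no vertex examined so far is a forbidden neighbour. -/
theorem runs_scan (A : BoundariedGraph t) {N k : ℕ} {σ : State} {c : Config N}
    (h : Represents k σ c) :
    Runs A.scan σ (A.copyError.cost + 1 + (N * (A.innerError.cost + 3 + 9) + 7) + 1)
      fun τ => ∃ m v, τ = (σ.setVar 4 m).setVar 5 v ∧
        (m = 0 ↔ A.Matches c fun i => σ.var (10 + i)) := by
  let F : ℕ → ℕ := fun v => A.innerError.eval (σ.setVar 5 v)
  have hrep : ∀ m v, Represents k ((σ.setVar 4 m).setVar 5 v) c := fun m v =>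
    (h.setVar le_rfl m).setVar (by omega) v
  have hw' : ∀ m v (i : ℕ), ((σ.setVar 4 m).setVar 5 v).var (10 + i) = σ.var (10 + i) :=
    fun m v i => by
      rw [State.var_setVar_of_ne _ _ (by omega), State.var_setVar_of_ne _ _ (by omega)]
  refine Runs.seq (R := fun τ => τ = σ.setVar 4 (A.copyError.eval σ)) (Runs.assign rfl) ?_
  rintro τ rfl
  refine Runs.forLoop (n := N) (fun i τ => ∃ m, τ = (σ.setVar 4 m).setVar 5 i ∧
      (m = 0 ↔ ∃ w : Fin A.n → Fin N, (∀ i : Fin A.n, σ.var (10 + i) = w i) ∧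
        Function.Injective w ∧ (∀ i, w i ∈ c.S) ∧
        (∀ i j, c.G.Adj (w i) (w j) ↔ A.graph.Adj i j) ∧ ∀ v : Fin N, v.1 < i →
          ∀ i, i ∉ Set.range A.terminal → v ∈ c.S → v ∉ Set.range w → ¬ c.G.Adj (w i) v))
    ?_ ?_ ?_ ?_ ?_
  · rintro i τ ⟨m, rfl, -⟩
    exact State.var_setVar_self _ _ _
  · rintro i τ ⟨m, rfl, -⟩
    exact (hrep m i).var_zero
  · refine ⟨_, rfl, ?_⟩
    simp only [Nat.not_lt_zero, false_imp_iff, implies_true, and_true]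
    exact A.eval_copyError h
  · rintro i τ hi ⟨m, rfl, hm⟩
    refine (Runs.assign ?_).mono (by simp only [Expr.cost]; omega) fun _ h => h
    refine ⟨?_, m + A.innerError.eval ((σ.setVar 4 m).setVar 5 i), ?_, ?_⟩
    · rw [State.var_setVar_of_ne _ _ (by omega), State.var_setVar_self]
    · simp only [Expr.eval, State.setVar, State.mk.injEq, and_true]
      funext y
      split_ifs <;> first | rfl | omega
    · rw [Nat.add_eq_zero_iff, hm]
      constructor
      · rintro ⟨⟨w, h1, h2, h3, h4, h5⟩, h6⟩
        refine ⟨w, h1, h2, h3, h4, fun v hv => ?_⟩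
        rcases Nat.lt_succ_iff_lt_or_eq.1 hv with hlt | heq
        · exact h5 v hlt
        · exact (A.eval_innerError (hrep m i) w (fun j => (hw' m i j).trans (h1 j)) h3 v
            (by rw [State.var_setVar_self, heq])).1 h6
      · rintro ⟨w, h1, h2, h3, h4, h5⟩
        refine ⟨⟨w, h1, h2, h3, h4, fun v hv => h5 v (by omega)⟩, ?_⟩
        exact (A.eval_innerError (hrep m i) w (fun j => (hw' m i j).trans (h1 j)) h3 ⟨i, hi⟩
          (State.var_setVar_self _ _ _)).2 (h5 ⟨i, hi⟩ (Nat.lt_succ_self i))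
  · rintro τ ⟨m, rfl, hm⟩
    refine ⟨m, N, rfl, hm.trans ⟨?_, ?_⟩⟩
    · rintro ⟨w, h1, h2, h3, h4, h5⟩
      exact ⟨w, h1, h2, h3, h4, fun i hi v => h5 v v.2 i hi⟩
    · rintro ⟨w, h1, h2, h3, h4, h5⟩
      exact ⟨w, h1, h2, h3, h4, fun v _ i hi => h5 i hi v⟩

end BoundariedGraph

/-! ### Carrying out a replacement in memory -/

namespace ParamGraphProblem.Replacement

open RAM BoundariedGraph

variable {P : ParamGraphProblem} {𝒢 : Set FinGraph} {t N : ℕ} {A : BoundariedGraph t}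

open Classical in
/-- The new edges. -/
noncomputable def edgeWrites (ρ : Replacement P 𝒢 A) : List (Expr × Expr × ℕ) :=
  (Finset.univ : Finset (Fin ρ.R.n × Fin ρ.R.n)).toList.map fun p =>
    (tupleVar (ρ.place p.1), tupleVar (ρ.place p.2), if ρ.R.graph.Adj p.1 p.2 then 1 else 0)

open Classical in
/-- The marks of the deleted vertices. -/
noncomputable def deadWrites (ρ : Replacement P 𝒢 A) : List (Expr × Expr × ℕ) :=
  ({j | j ∉ Set.range ρ.place} : Finset (Fin A.n)).toList.map fun j : Fin A.n =>
    (tupleVar j, .const 0, 1)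

/-- Replace the current tuple. -/
noncomputable def replaceProg (ρ : Replacement P 𝒢 A) : Prog :=
  .seq (Prog.writes 0 ρ.edgeWrites) (.seq (Prog.writes 2 ρ.deadWrites)
    (.seq (.assign 2 (.sub (.var 2) (.const (A.n - ρ.R.n))))
      (.assign 3 (.add (.var 3) (.const ρ.shift)))))

/-- The reduced instance after the replacement of the tuple `w`. -/
noncomputable def newConfig (ρ : Replacement P 𝒢 A) (c : Config N) (w : Fin A.n → Fin N) :
    Config N :=
  ⟨ρ.newSet c.S w, ρ.newGraph c.G w, c.sh + ρ.shift⟩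

theorem runs_replaceProg (ρ : Replacement P 𝒢 A) {k : ℕ} {σ : State} {c : Config N}
    (h : Represents k σ c) {w : Fin A.n → Fin N} (hw : ∀ i : Fin A.n, σ.var (10 + i) = w i)
    (hm : A.IsMatch c.S c.G w) :
    Runs ρ.replaceProg σ (Prog.writesCost ρ.edgeWrites + (Prog.writesCost ρ.deadWrites + 10) + 1)
      fun τ => (∀ x, 4 ≤ x → τ.var x = σ.var x) ∧ Represents k τ (ρ.newConfig c w) := by
  classical
  -- `f₀` and `f₂` are the contents of the adjacency array and of the deletion marks after the
  -- writes, which gives a description independent of the order of writing.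
  let f₀ : ℕ → ℕ → ℕ := fun x y =>
    if (∃ a, (w (ρ.place a) : ℕ) = x) ∧ ∃ b, (w (ρ.place b) : ℕ) = y then
      if ∃ a b, (w (ρ.place a) : ℕ) = x ∧ (w (ρ.place b) : ℕ) = y ∧ ρ.R.graph.Adj a b then 1 else 0
    else σ.arr 0 x y
  let f₂ : ℕ → ℕ → ℕ := fun x y =>
    if y = 0 ∧ ∃ j, j ∉ Set.range ρ.place ∧ (w j : ℕ) = x then 1 else σ.arr 2 x y
  have hinj : ∀ {a b}, (w (ρ.place a) : ℕ) = w (ρ.place b) → a = b := fun hab =>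
    ρ.place.injective (hm.injective (Fin.ext hab))
  refine Runs.seq (Runs.writes f₀ ρ.edgeWrites ?_ ?_ ?_) ?_
  · intro e he σ τ hστ
    obtain ⟨p, -, rfl⟩ := List.mem_map.1 he
    simp only [Expr.eval, hστ, and_self]
  · intro e he
    obtain ⟨p, -, rfl⟩ := List.mem_map.1 he
    simp only [Expr.eval, hw, f₀]
    rw [if_pos ⟨⟨_, rfl⟩, ⟨_, rfl⟩⟩]
    congr 1
    refine propext ⟨?_, fun hp => ⟨_, _, rfl, rfl, hp⟩⟩
    rintro ⟨a, b, h1, h2, h3⟩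
    rwa [hinj h1, hinj h2] at h3
  · intro x y hxy
    refine (if_neg ?_).symm
    rintro ⟨⟨a, rfl⟩, ⟨b, rfl⟩⟩
    refine hxy _ (List.mem_map.2 ⟨(a, b), by simp, rfl⟩) ?_
    simp only [Expr.eval, hw, and_self]
  rintro τ₁ rfl
  refine (Runs.seq (T := 9) (Runs.writes f₂ ρ.deadWrites ?_ ?_ ?_) ?_).mono (by omega)
    fun _ h => h
  · intro e he σ τ hστ
    obtain ⟨p, -, rfl⟩ := List.mem_map.1 he
    simp only [Expr.eval, hστ, and_self]
  · intro e he
    obtain ⟨j, hj, rfl⟩ := List.mem_map.1 he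
    change f₂ (σ.var (10 + j)) 0 = 1
    rw [hw]
    refine if_pos ⟨rfl, j, ?_, rfl⟩
    simpa using hj
  · intro x y hxy
    change σ.arr 2 x y = f₂ x y
    refine (if_neg ?_).symm
    rintro ⟨rfl, ⟨j, hj, rfl⟩⟩
    exact hxy _ (List.mem_map.2 ⟨j, by simpa using hj, rfl⟩) ⟨hw j, rfl⟩
  rintro τ₂ rfl
  refine (Runs.seq (R := fun τ => τ = State.setVar _ _ _) (Runs.assign rfl) (T := 4)
    fun τ hτ => ?_).mono (by simp only [Expr.cost]; omega) fun _ h => h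
  subst hτ
  refine (Runs.assign ?_).mono (by simp only [Expr.cost]; omega) fun _ h => h
  have hcard := ρ.card_newSet hm
  have hmem : ∀ v : Fin N, v ∈ ρ.newSet c.S w ↔
      v ∈ c.S ∧ ¬ ∃ j, j ∉ Set.range ρ.place ∧ (w j : ℕ) = v := by
    intro v
    rw [ρ.mem_newSet]
    refine and_congr_right fun _ => ⟨?_, fun h j hj => ?_⟩
    · rintro h ⟨j, h1, h2⟩
      exact h1 (h j (Fin.ext h2))
    · by_contra hn
      exact h ⟨j, hn, congrArg Fin.val hj⟩
  have hv2 := h.var_two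
  have hv3 := h.var_three
  refine ⟨fun x hx => ?_, ?_⟩
  · rw [State.var_setVar_of_ne _ _ (by omega), State.var_setVar_of_ne _ _ (by omega)]
  · refine ⟨?_, ?_, ?_, ?_, ?_, ?_, ?_⟩
    · rw [State.var_setVar_of_ne _ _ (by omega), State.var_setVar_of_ne _ _ (by omega)]
      exact h.var_zero
    · rw [State.var_setVar_of_ne _ _ (by omega), State.var_setVar_of_ne _ _ (by omega)]
      exact h.var_one
    · rw [State.var_setVar_of_ne _ _ (by omega), State.var_setVar_self]
      simp only [Expr.eval, newConfig]
      omega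
    · rw [State.var_setVar_self]
      simp only [Expr.eval, newConfig]
      rw [State.var_setVar_of_ne _ _ (by omega)]
      exact congrArg (· + ρ.shift) hv3
    · intro v
      change f₂ v 0 = if v ∈ ρ.newSet c.S w then 0 else 1
      have key : ∀ (p q : Prop) [Decidable p] [Decidable q], (if p then 1 else if q then 0 else 1) =
          if q ∧ ¬ p then 0 else 1 := fun p q _ _ => by
        by_cases hp : p <;> by_cases hq : q <;> simp [hp, hq]
      simp only [f₂, true_and, h.dead, hmem]
      exact key _ _
    · intro u hu v hv
      change f₀ u v = if (ρ.newGraph c.G w).Adj u v then 1 else 0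
      have hu' := ((hmem u).1 hu).1
      have hv' := ((hmem v).1 hv).1
      simp only [f₀, h.adj u hu' v hv', newGraph, ← Fin.ext_iff]
      by_cases hin : (∃ a, w (ρ.place a) = u) ∧ ∃ b, w (ρ.place b) = v
      · rw [if_pos hin]
        congr 1
        refine propext ⟨?_, ?_⟩
        · rintro ⟨a, b, rfl, rfl, hab⟩
          exact ⟨fun heq => hab.ne (hinj (congrArg Fin.val heq)), Or.inl ⟨a, b, rfl, rfl, hab⟩⟩
        · rintro ⟨-, h1 | h1⟩
          · exact h1
          · exact absurd hin h1.2
      · rw [if_neg hin]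
        congr 1
        refine propext ⟨fun hadj => ⟨hadj.ne, Or.inr ⟨hadj, hin⟩⟩, ?_⟩
        rintro ⟨-, ⟨a, b, h1, h2, -⟩ | h1⟩
        · exact absurd ⟨⟨a, h1⟩, ⟨b, h2⟩⟩ hin
        · exact h1.1
    · intro u v
      change f₀ u v ≤ 1
      have := h.le_one u v
      simp only [f₀]
      split_ifs <;> omega

end ParamGraphProblem.Replacement

/-! ### Exhaustive search over tuples -/

namespace RAM

variable {N : ℕ}

/-- The program `p` preserves the tuple variables from the `j`-th on, and either it makes the
reduced instance smaller, or it leaves it unchanged and the instance satisfies `M` for no values of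
the tuple variables before the `j`-th. -/
def Reduces (N k : ℕ) (Good : Config N → Prop) (p : Prog) (T j : ℕ)
    (M : Config N → (ℕ → ℕ) → Prop) : Prop :=
  ∀ σ c, Represents k σ c → Good c → Runs p σ T fun τ =>
    (∀ i, j ≤ i → τ.var (10 + i) = σ.var (10 + i)) ∧ τ.var 6 = σ.var 6 ∧
    ∃ c', Represents k τ c' ∧ Good c' ∧ (c'.S.card < c.S.card ∨ (c' = c ∧ ∀ u : ℕ → ℕ,
      (∀ i, j ≤ i → u i = σ.var (10 + i)) → (∀ i < j, u i < N) → ¬ M c u))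

/-- Run `p` for all values of the tuple variables before the `j`-th. -/
def tupleLoop (p : Prog) : ℕ → Prog
  | 0 => p
  | j + 1 => Prog.forLoop (10 + j) 0 (tupleLoop p j)

/-- The number of living vertices never grows, so one shrinking iteration makes the whole loop
shrink. If none shrinks, the instance is the same throughout and each iteration has excluded one
value of the `j`-th entry. -/
theorem Reduces.forLoop {k : ℕ} {Good : Config N → Prop} {p : Prog} {T j : ℕ}
    {M : Config N → (ℕ → ℕ) → Prop} (h : Reduces N k Good p T j M) :
    Reduces N k Good (Prog.forLoop (10 + j) 0 p) (N * (T + 9) + 7) (j + 1) M := by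
  intro σ c hσ hc
  refine Runs.forLoop (n := N) (fun i τ => τ.var (10 + j) = i ∧
      (∀ i, j + 1 ≤ i → τ.var (10 + i) = σ.var (10 + i)) ∧ τ.var 6 = σ.var 6 ∧
      ∃ c', Represents k τ c' ∧ Good c' ∧ (c'.S.card < c.S.card ∨ (c' = c ∧ ∀ u : ℕ → ℕ,
        (∀ i, j + 1 ≤ i → u i = σ.var (10 + i)) → u j < i → (∀ i < j, u i < N) → ¬ M c u)))
    (fun i τ hτ => hτ.1) ?_ ?_ ?_ ?_
  · rintro i τ ⟨-, -, -, c', h1, -⟩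
    exact h1.var_zero
  · refine ⟨State.var_setVar_self _ _ _, fun i hi => State.var_setVar_of_ne _ _ (by omega),
      State.var_setVar_of_ne _ _ (by omega), c, hσ.setVar (by omega) _, hc, Or.inr ⟨rfl, ?_⟩⟩
    exact fun u _ hu => absurd hu (Nat.not_lt_zero _)
  · rintro i τ hi ⟨h1, h2, h3, c₁, h4, h5, h6⟩
    refine (h τ c₁ h4 h5).mono le_rfl ?_
    rintro υ ⟨g1, g2, c₂, g3, g4, g5⟩
    refine ⟨(g1 j le_rfl).trans h1, State.var_setVar_self _ _ _, fun i' hi' => ?_, ?_, c₂,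
      g3.setVar (by omega) _, g4, ?_⟩
    · rw [State.var_setVar_of_ne _ _ (by omega), g1 i' (by omega), h2 i' hi']
    · rw [State.var_setVar_of_ne _ _ (by omega), g2, h3]
    · rcases h6 with h6 | ⟨rfl, h6⟩
      · left
        rcases g5 with g5 | ⟨rfl, -⟩
        · exact g5.trans h6
        · exact h6
      · rcases g5 with g5 | ⟨rfl, g5⟩
        · exact Or.inl g5
        · refine Or.inr ⟨rfl, fun u hu huj hu' => ?_⟩
          rcases Nat.lt_succ_iff_lt_or_eq.1 huj with hlt | heq
          · exact h6 u hu hlt hu'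
          · refine g5 u (fun i' hi' => ?_) hu'
            rcases hi'.eq_or_lt with rfl | hlt
            · rw [heq, h1]
            · rw [hu i' hlt, h2 i' hlt]
  · rintro τ ⟨-, h2, h3, c', h4, h5, h6⟩
    refine ⟨h2, h3, c', h4, h5, h6.imp_right fun h6 => ⟨h6.1, fun u hu hu' => ?_⟩⟩
    exact h6.2 u hu (hu' j (Nat.lt_succ_self j)) fun i hi => hu' i (by omega)

open Polynomial in
theorem Reduces.tupleLoop {p : Prog} (q : ℕ[X]) (j : ℕ) :
    ∃ r : ℕ[X], ∀ (N k : ℕ) (Good : Config N → Prop) (M : Config N → (ℕ → ℕ) → Prop),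
      Reduces N k Good p (q.eval N) 0 M →
      Reduces N k Good (RAM.tupleLoop p j) (r.eval N) j M := by
  induction j with
  | zero => exact ⟨q, fun N k Good M h => h⟩
  | succ j ih =>
    obtain ⟨r, hr⟩ := ih
    -- Each nested loop multiplies the time by about `N`; the nesting depth is the size of the
    -- pattern, a constant.
    refine ⟨X * (r + 9) + 7, fun N k Good M h => ?_⟩
    have := (hr N k Good M h).forLoop
    simpa [RAM.tupleLoop] using this

end RAM

namespace ParamGraphProblem.Replacement

open RAM BoundariedGraph Polynomial

variable {P : ParamGraphProblem} {𝒢 : Set FinGraph} {t : ℕ} {A : BoundariedGraph t}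

/-- Replace the current tuple if it matches. -/
noncomputable def tryProg (ρ : Replacement P 𝒢 A) : Prog :=
  .seq A.scan (.ite (.var 4) Prog.skip ρ.replaceProg)

theorem reduces_tryProg (ρ : Replacement P 𝒢 A) : ∃ q : ℕ[X],
    ∀ (N k : ℕ) (Good : Config N → Prop),
      (∀ c w, Good c → A.IsMatch c.S c.G w → Good (ρ.newConfig c w)) →
      Reduces N k Good ρ.tryProg (q.eval N) 0 A.Matches := by
  refine ⟨C (A.copyError.cost + 1) + (X * C (A.innerError.cost + 3 + 9) + 7) + 1 +
    C (1 + (2 + (Prog.writesCost ρ.edgeWrites + (Prog.writesCost ρ.deadWrites + 10) + 1)) + 1) + 1,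
    fun N k Good hgood σ c hσ hc => ?_⟩
  refine (Runs.seq (T := 1 + (2 + (Prog.writesCost ρ.edgeWrites +
    (Prog.writesCost ρ.deadWrites + 10) + 1)) + 1) (A.runs_scan hσ) fun τ hτ => ?_).mono
    (by simp) fun _ h => h
  obtain ⟨m, v, rfl, hm⟩ := hτ
  have hrep : Represents k ((σ.setVar 4 m).setVar 5 v) c :=
    (hσ.setVar le_rfl m).setVar (by omega) v
  have hvar : ∀ i, 6 ≤ i → ((σ.setVar 4 m).setVar 5 v).var i = σ.var i := fun i hi => by
    rw [State.var_setVar_of_ne _ _ (by omega), State.var_setVar_of_ne _ _ (by omega)]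
  have h4 : ((σ.setVar 4 m).setVar 5 v).var 4 = m := by
    rw [State.var_setVar_of_ne _ _ (by omega), State.var_setVar_self]
  refine Runs.ite (e := .var 4) (fun hne => Runs.skip ?_) fun h0 => ?_
  · rw [Expr.eval, h4] at hne
    refine ⟨fun i _ => hvar _ (by omega), hvar _ le_rfl, c, hrep, hc, Or.inr ⟨rfl, ?_⟩⟩
    intro u hu _
    have : u = fun i => σ.var (10 + i) := funext fun i => hu i (Nat.zero_le _)
    rw [this]
    exact fun hM => hne (hm.2 hM)
  · rw [Expr.eval, h4] at h0
    obtain ⟨w, hw, hmatch⟩ := hm.1 h0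
    refine (ρ.runs_replaceProg hrep (fun i => (hvar _ (by omega)).trans (hw i)) hmatch).mono le_rfl
      fun υ hυ => ?_
    refine ⟨fun i _ => (hυ.1 _ (by omega)).trans (hvar _ (by omega)),
      (hυ.1 _ (by omega)).trans (hvar _ le_rfl), _, hυ.2, hgood c w hc hmatch, Or.inl ?_⟩
    have := ρ.card_newSet hmatch
    have := ρ.lt
    simp only [newConfig]
    omega

end ParamGraphProblem.Replacement

/-! ### Passes through the table of rules -/

namespace RAM

open ParamGraphProblem BoundariedGraph Polynomial

variable {P : ParamGraphProblem} {𝒢 : Set FinGraph}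

/-- Try all rules of a list once, in all places. -/
noncomputable def pass : List (Σ x : (Σ t, BoundariedGraph t), Replacement P 𝒢 x.2) → Prog
  | [] => Prog.skip
  | ρ :: L => .seq (tupleLoop ρ.2.tryProg ρ.1.2.n) (pass L)

/-- A pass makes the reduced instance smaller, unless no rule applies. -/
theorem runs_pass (L : List (Σ x : (Σ t, BoundariedGraph t), Replacement P 𝒢 x.2)) : ∃ q : ℕ[X],
    ∀ (N k : ℕ) (Good : Config N → Prop),
      (∀ ρ ∈ L, ∀ c w, Good c → ρ.1.2.IsMatch c.S c.G w → Good (ρ.2.newConfig c w)) →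
      ∀ σ (c : Config N), Represents k σ c → Good c → Runs (pass L) σ (q.eval N) fun τ =>
        τ.var 6 = σ.var 6 ∧ ∃ c' : Config N, Represents k τ c' ∧ Good c' ∧
          (c'.S.card < c.S.card ∨
            (c' = c ∧ ∀ ρ ∈ L, ∀ w : Fin ρ.1.2.n → Fin N, ¬ ρ.1.2.IsMatch c.S c.G w)) := by
  induction L with
  | nil =>
    exact ⟨2, fun N k Good _ σ c hσ hc => (Runs.skip ⟨rfl, c, hσ, hc, Or.inr ⟨rfl, by simp⟩⟩).mono
      (by simp) fun _ h => h⟩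
  | cons ρ L ih =>
    obtain ⟨q, hq⟩ := ih
    obtain ⟨q₁, hq₁⟩ := ρ.2.reduces_tryProg
    obtain ⟨q₂, hq₂⟩ := Reduces.tupleLoop (p := ρ.2.tryProg) q₁ ρ.1.2.n
    refine ⟨q₂ + q + 1, fun N k Good hgood σ c hσ hc => ?_⟩
    have h1 := hq₂ N k Good _ (hq₁ N k Good (hgood ρ List.mem_cons_self)) σ c hσ hc
    refine (Runs.seq (T := q.eval N) h1 ?_).mono (by simp) fun _ h => h
    rintro τ ⟨-, h2, c₁, h3, h4, h5⟩
    refine (hq N k Good (fun ρ' hρ' => hgood ρ' (List.mem_cons_of_mem _ hρ')) τ c₁ h3 h4).mono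
      le_rfl ?_
    rintro υ ⟨g1, c₂, g2, g3, g4⟩
    refine ⟨g1.trans h2, c₂, g2, g3, ?_⟩
    rcases h5 with h5 | ⟨rfl, h5⟩
    · left
      rcases g4 with g4 | ⟨rfl, -⟩
      · exact g4.trans h5
      · exact h5
    · rcases g4 with g4 | ⟨rfl, g4⟩
      · exact Or.inl g4
      · refine Or.inr ⟨rfl, fun ρ' hρ' => ?_⟩
        rcases List.mem_cons.1 hρ' with rfl | hρ'
        · intro w hw
          -- The tuple is read off from the supposed match; the variables beyond it keep their
          -- current values, as the exclusion statement requires.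
          refine h5 (fun i => if h : i < ρ'.1.2.n then w ⟨i, h⟩ else σ.var (10 + i))
            (fun i hi => dif_neg (by omega)) (fun i hi => ?_) ⟨w, fun i => ?_, hw⟩
          · simp only [dif_pos hi, Fin.is_lt]
          · simp
        · exact g4 ρ' hρ'

end RAM

/-! ### The kernelization program -/

namespace RAM

open ParamGraphProblem BoundariedGraph Polynomial

variable {P : ParamGraphProblem} {𝒢 : Set FinGraph}

/-- Make passes until no rule applies. -/
noncomputable def reduceProg (L : List (Σ x : (Σ t, BoundariedGraph t), Replacement P 𝒢 x.2)) :
    Prog :=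
  .seq (.assign 2 (.var 0)) (.seq (.assign 6 (.add (.var 0) (.const 1)))
    (.while (.sub (.var 6) (.var 2)) (.seq (.assign 6 (.var 2)) (pass L))))

/-- Here `x₆` remembers the number of living vertices before the last pass. The loop stops when a
pass has not lowered it, which means that no rule applies. As `x₆` itself strictly decreases, there
are at most `N + 1` passes. -/
theorem runs_reduceProg (L : List (Σ x : (Σ t, BoundariedGraph t), Replacement P 𝒢 x.2)) :
    ∃ q : ℕ[X], ∀ (N k : ℕ) (Good : Config N → Prop),
      (∀ ρ ∈ L, ∀ c w, Good c → ρ.1.2.IsMatch c.S c.G w → Good (ρ.2.newConfig c w)) →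
      ∀ σ (c : Config N), σ.var 0 = N → Represents k (σ.setVar 2 N) c → Good c →
        Runs (reduceProg L) σ (q.eval N) fun τ => ∃ c' : Config N, Represents k τ c' ∧ Good c' ∧
          ∀ ρ ∈ L, ∀ w : Fin ρ.1.2.n → Fin N, ¬ ρ.1.2.IsMatch c'.S c'.G w := by
  obtain ⟨q, hq⟩ := runs_pass L
  refine ⟨2 + (4 + ((X + 1) * (3 + (2 + q + 1) + 1) + 3 + 1) + 1) + 1,
    fun N k Good hgood σ c hN hσ hc => ?_⟩
  have hloop : Runs (.while (.sub (.var 6) (.var 2)) (.seq (.assign 6 (.var 2)) (pass L)))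
      ((σ.setVar 2 N).setVar 6 (N + 1)) ((N + 1) * (3 + (2 + q.eval N + 1) + 1) + 3 + 1)
      fun τ => ∃ c' : Config N, Represents k τ c' ∧ Good c' ∧
        ∀ ρ ∈ L, ∀ w : Fin ρ.1.2.n → Fin N, ¬ ρ.1.2.IsMatch c'.S c'.G w := by
    refine Runs.whileLoop (e := .sub (.var 6) (.var 2)) (fun τ => ∃ c' : Config N,
      Represents k τ c' ∧ Good c' ∧ c'.S.card ≤ τ.var 6 ∧ (τ.var 6 = c'.S.card →
        ∀ ρ ∈ L, ∀ w : Fin ρ.1.2.n → Fin N, ¬ ρ.1.2.IsMatch c'.S c'.G w))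
      (fun τ => τ.var 6) ?_ ?_ ?_ (State.var_setVar_self _ _ _).le
    · rintro τ ⟨c₁, h1, h2, h3, h4⟩ hne
      simp only [Expr.eval, h1.var_two] at hne
      refine (Runs.seq (R := fun υ => υ = τ.setVar 6 c₁.S.card)
        (Runs.assign (by simp only [Expr.eval, h1.var_two])) (T := q.eval N) ?_)
      rintro υ rfl
      refine (hq N k Good hgood _ c₁ (h1.setVar (by omega) _) h2).mono le_rfl ?_
      rintro υ ⟨g1, c₂, g2, g3, g4⟩
      rw [State.var_setVar_self] at g1
      refine ⟨⟨c₂, g2, g3, ?_, fun heq => ?_⟩, by omega⟩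
      · rcases g4 with g4 | ⟨rfl, -⟩
        · omega
        · exact g1.ge
      · rcases g4 with g4 | ⟨rfl, g4⟩
        · omega
        · exact g4
    · rintro τ ⟨c₁, h1, h2, h3, h4⟩ h0
      simp only [Expr.eval, h1.var_two] at h0
      exact ⟨c₁, h1, h2, h4 (by omega)⟩
    -- Starting `x₆` at `N + 1`, above the number of vertices, forces a first pass and makes the
    -- second clause of the invariant vacuous.
    · have hS : c.S.card = N := by rw [← hσ.var_two, State.var_setVar_self]
      refine ⟨c, hσ.setVar (by omega) _, hc, ?_, fun heq => ?_⟩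
      · rw [State.var_setVar_self]; omega
      · rw [State.var_setVar_self] at heq; omega
  refine (Runs.seq (R := fun τ => τ = σ.setVar 2 N) (Runs.assign (by simp only [Expr.eval, hN]))
    fun τ hτ => Runs.seq (R := fun τ => τ = (σ.setVar 2 N).setVar 6 (N + 1))
      (Runs.assign ?_) fun υ hυ => hυ ▸ hloop).mono ?_ fun _ h => h
  · subst hτ
    simp only [Expr.eval]
    rw [State.var_setVar_of_ne _ _ (by omega), hN]
  · simp [Expr.cost]

/-! ### Output -/

open Classical in
/-- Output a constant instance. -/
noncomputable def outputProg (H : FinGraph) (l : ℕ) : Prog :=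
  .seq (Prog.writes 0 ((Finset.univ : Finset (Fin H.n × Fin H.n)).toList.map fun p =>
      (.const p.1, .const p.2, if H.graph.Adj p.1 p.2 then 1 else 0)))
    (.seq (.assign 0 (.const H.n)) (.assign 1 (.const l)))

theorem runs_outputProg (H : FinGraph) (l : ℕ) : ∃ T, ∀ σ,
    Runs (outputProg H l) σ T fun τ => Outputs τ H l := by
  classical
  refine ⟨_, fun σ => Runs.seq (T := 5) (Runs.writes (fun x y => if h : x < H.n ∧ y < H.n then
    if H.graph.Adj ⟨x, h.1⟩ ⟨y, h.2⟩ then 1 else 0 else σ.arr 0 x y) _ ?_ ?_ ?_) ?_⟩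
  · intro e he σ τ _
    obtain ⟨p, -, rfl⟩ := List.mem_map.1 he
    exact ⟨rfl, rfl⟩
  · intro e he
    obtain ⟨p, -, rfl⟩ := List.mem_map.1 he
    exact dif_pos (⟨p.1.2, p.2.2⟩ : p.1.1 < H.n ∧ p.2.1 < H.n)
  · intro x y hxy
    have hn : ¬ (x < H.n ∧ y < H.n) := fun ⟨hx, hy⟩ =>
      hxy _ (List.mem_map.2 ⟨(⟨x, hx⟩, ⟨y, hy⟩), by simp, rfl⟩) ⟨rfl, rfl⟩
    rw [dif_neg hn]
  · rintro τ rfl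
    refine Runs.seq (S := 2) (R := fun τ => τ = State.setVar _ 0 H.n) (Runs.assign rfl) (T := 2) ?_
    rintro τ rfl
    refine Runs.assign ?_
    exact ⟨rfl, rfl, fun i j => dif_pos (⟨i.2, j.2⟩ : i.1 < H.n ∧ j.1 < H.n)⟩

/-- List the living vertices in `A₃`. -/
def indexProg : Prog :=
  .seq (.assign 7 (.const 0)) (Prog.forLoop 5 0 (.ite (.read 2 (.var 5) (.const 0)) Prog.skip
    (.seq (.write 3 (.var 7) (.const 0) (.var 5)) (.assign 7 (.add (.var 7) (.const 1))))))

theorem card_filter_lt_succ {N i : ℕ} (S : Finset (Fin N)) (hi : i < N) :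
    (S.filter fun v => v.1 < i + 1).card =
      (S.filter fun v => v.1 < i).card + if (⟨i, hi⟩ : Fin N) ∈ S then 1 else 0 := by
  split_ifs with h
  · have : (S.filter fun v => v.1 < i + 1) = insert ⟨i, hi⟩ (S.filter fun v => v.1 < i) := by
      ext v
      simp only [Finset.mem_filter, Finset.mem_insert, Nat.lt_succ_iff_lt_or_eq, Fin.ext_iff]
      constructor
      · rintro ⟨h1, h2 | h2⟩
        · exact Or.inr ⟨h1, h2⟩
        · exact Or.inl h2
      · rintro (h1 | h1)
        · exact ⟨by rwa [show v = ⟨i, hi⟩ from Fin.ext h1], Or.inr h1⟩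
        · exact ⟨h1.1, Or.inl h1.2⟩
    rw [this, Finset.card_insert_of_notMem (by simp)]
  · rw [add_zero]
    congr 1
    refine Finset.filter_congr fun v hv => ?_
    have : v.1 ≠ i := fun heq => h (by rwa [show v = ⟨i, hi⟩ from Fin.ext heq] at hv)
    omega

/-- The counter `x₇` equals the number `cnt i` of living vertices below `i`. The list stays
injective because every listed vertex is smaller than the one about to be appended. -/
theorem runs_indexProg {N k : ℕ} {σ : State} {c : Config N} (h : Represents k σ c) :
    Runs indexProg σ (2 + (N * (15 + 9) + 7) + 1) fun τ =>
      (∀ z, z < 5 → τ.var z = σ.var z) ∧ (∀ a, a ≠ 3 → τ.arr a = σ.arr a) ∧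
      ∃ idx : Fin c.S.card → Fin N, Function.Injective idx ∧ (∀ j, idx j ∈ c.S) ∧
        ∀ j : Fin c.S.card, τ.arr 3 j 0 = idx j := by
  let cnt : ℕ → ℕ := fun i => (c.S.filter fun v => v.1 < i).card
  refine Runs.seq (R := fun τ => τ = σ.setVar 7 0) (Runs.assign rfl) ?_
  rintro τ rfl
  refine Runs.forLoop (n := N) (fun i τ => τ.var 5 = i ∧ τ.var 7 = cnt i ∧
      (∀ z, z < 5 → τ.var z = σ.var z) ∧ (∀ a, a ≠ 3 → τ.arr a = σ.arr a) ∧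
      (∀ j < cnt i, ∃ v ∈ c.S, v.1 < i ∧ τ.arr 3 j 0 = v) ∧
      ∀ j j', j < cnt i → j' < cnt i → τ.arr 3 j 0 = τ.arr 3 j' 0 → j = j')
    (fun i τ h => h.1) (fun i τ hτ => (hτ.2.2.1 0 (by omega)).trans h.var_zero) ?_ ?_ ?_
  · have h0 : cnt 0 = 0 := by simp [cnt]
    refine ⟨State.var_setVar_self _ _ _, ?_, fun z hz => ?_, fun _ _ => rfl, ?_, ?_⟩
    · rw [State.var_setVar_of_ne _ _ (by omega), State.var_setVar_self, h0]
    · rw [State.var_setVar_of_ne _ _ (by omega), State.var_setVar_of_ne _ _ (by omega)]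
    · rw [h0]; exact fun j hj => absurd hj (Nat.not_lt_zero _)
    · rw [h0]; exact fun j _ hj => absurd hj (Nat.not_lt_zero _)
  · rintro i τ hi ⟨h1, h2, h3, h4, h5, h6⟩
    have hsucc : cnt (i + 1) = cnt i + if (⟨i, hi⟩ : Fin N) ∈ c.S then 1 else 0 :=
      card_filter_lt_succ c.S hi
    have hdead := h.dead ⟨i, hi⟩
    have hval : (Expr.read 2 (.var 5) (.const 0)).eval τ =
        if (⟨i, hi⟩ : Fin N) ∈ c.S then 0 else 1 := by
      simp only [Expr.eval, h1, h4 2 (by omega)]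
      exact hdead
    refine (Runs.ite (S := 2) (T := 9) (fun hne => Runs.skip ?_) fun h0 => ?_).mono
      (by simp only [Expr.cost]; omega) fun _ h => h
    · rw [hval] at hne
      have hnS : (⟨i, hi⟩ : Fin N) ∉ c.S := fun hS => hne (if_pos hS)
      rw [if_neg hnS, add_zero] at hsucc
      refine ⟨h1, State.var_setVar_self _ _ _, ?_, fun z hz => ?_, h4, ?_, ?_⟩
      · rw [State.var_setVar_of_ne _ _ (by omega), h2, hsucc]
      · rw [State.var_setVar_of_ne _ _ (by omega), h3 z hz]
      · rw [hsucc]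
        intro j hj
        obtain ⟨v, hv, hvi, hjv⟩ := h5 j hj
        exact ⟨v, hv, by omega, hjv⟩
      · rw [hsucc]; exact h6
    · rw [hval] at h0
      have hS : (⟨i, hi⟩ : Fin N) ∈ c.S := by
        by_contra hS
        rw [if_neg hS] at h0
        exact one_ne_zero h0
      rw [if_pos hS] at hsucc
      refine Runs.seq (S := 4) (R := fun υ => υ = τ.setArr 3 (cnt i) 0 i)
        (Runs.write (by simp only [Expr.eval, h1, h2])) (T := 4) ?_
      rintro υ rfl
      refine (Runs.assign ?_).mono (by simp only [Expr.cost]; omega) fun _ h => h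
      have hold : ∀ j, j ≠ cnt i → (τ.setArr 3 (cnt i) 0 i).arr 3 j 0 = τ.arr 3 j 0 :=
        fun j hj => if_neg fun hh => hj hh.2.1
      have hnew : (τ.setArr 3 (cnt i) 0 i).arr 3 (cnt i) 0 = i := if_pos ⟨rfl, rfl, rfl⟩
      refine ⟨?_, State.var_setVar_self _ _ _, ?_, fun z hz => ?_, fun a ha => ?_, ?_, ?_⟩
      · rw [State.var_setVar_of_ne _ _ (by omega)]
        exact h1
      · rw [State.var_setVar_of_ne _ _ (by omega), State.var_setVar_self, hsucc]
        exact congrArg (· + 1) h2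
      · rw [State.var_setVar_of_ne _ _ (by omega), State.var_setVar_of_ne _ _ (by omega)]
        exact h3 z hz
      · rw [← h4 a ha]
        funext r s
        exact if_neg fun hh => ha hh.1
      · rw [hsucc]
        intro j hj
        simp only [State.arr_setVar]
        rcases Nat.lt_succ_iff_lt_or_eq.1 hj with hlt | rfl
        · rw [hold j hlt.ne]
          obtain ⟨v, hv, hvi, hjv⟩ := h5 j hlt
          exact ⟨v, hv, by omega, hjv⟩
        · exact ⟨⟨i, hi⟩, hS, Nat.lt_succ_self i, hnew⟩
      · rw [hsucc]
        intro j j' hj hj' heq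
        simp only [State.arr_setVar] at heq
        rcases Nat.lt_succ_iff_lt_or_eq.1 hj with hlt | rfl
        · rcases Nat.lt_succ_iff_lt_or_eq.1 hj' with hlt' | rfl
          · rw [hold j hlt.ne, hold j' hlt'.ne] at heq
            exact h6 j j' hlt hlt' heq
          · rw [hold j hlt.ne, hnew] at heq
            obtain ⟨v, -, hvi, hjv⟩ := h5 j hlt
            omega
        · rcases Nat.lt_succ_iff_lt_or_eq.1 hj' with hlt' | rfl
          · rw [hold j' hlt'.ne, hnew] at heq
            obtain ⟨v, -, hvi, hjv⟩ := h5 j' hlt'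
            omega
          · rfl
  · rintro τ ⟨h1, h2, h3, h4, h5, h6⟩
    have hN : cnt N = c.S.card := by
      simp only [cnt]
      rw [Finset.filter_true_of_mem fun v _ => v.2]
    rw [hN] at h5 h6
    choose g hg using h5
    have hgv : ∀ j : Fin c.S.card, τ.arr 3 j 0 = (g j j.2 : ℕ) := fun j => (hg j j.2).2.2
    refine ⟨h3, h4, fun j => g j j.2, fun i j hij => ?_, fun j => (hg j j.2).1, hgv⟩
    refine Fin.ext (h6 i j i.2 j.2 ?_)
    rw [hgv, hgv, show g i i.2 = g j j.2 from hij]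

/-- Output the reduced instance. -/
def compressProg : Prog :=
  .seq indexProg
    (.seq (Prog.fill 1 5 8 2 (.read 0 (.read 3 (.var 5) (.const 0)) (.read 3 (.var 8) (.const 0))))
      (.seq (Prog.fill 0 5 8 2 (.read 1 (.var 5) (.var 8)))
        (.seq (.assign 0 (.var 2)) (.assign 1 (.sub (.var 1) (.var 3))))))

/-- The matrix is first collected in the scratch array `A₁` and then copied back: compacting `A₀` in
place could overwrite entries that are still to be read, and `Runs.fill` asks for values independent
of the target array. -/
theorem runs_compressProg {N k : ℕ} {σ : State} {c : Config N} (h : Represents k σ c) :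
    Runs compressProg σ ((2 + (N * (15 + 9) + 7) + 1) + ((N * (N * (7 + 12) + 16) + 7) +
      ((N * (N * (3 + 12) + 16) + 7) + (2 + 4 + 1) + 1) + 1) + 1) fun τ => ∃ G' : FinGraph,
        Nonempty (G'.graph ≃g (FinGraph.ofInduced c.S c.G).graph) ∧ G'.n = c.S.card ∧
        Outputs τ G' (k - c.sh) := by
  classical
  have hSN : c.S.card ≤ N := by simpa using Finset.card_le_univ c.S
  refine Runs.seq (runs_indexProg h) ?_
  rintro τ ⟨h1, h2, idx, h3, h4, h5⟩
  have hτ2 : τ.var 2 = c.S.card := (h1 2 (by omega)).trans h.var_two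
  have hmono : ∀ a, c.S.card * (c.S.card * a + 16) + 7 ≤ N * (N * a + 16) + 7 := fun a => by
    gcongr
  refine Runs.seq ((Runs.fill (n := c.S.card) (by omega) (by omega) (by omega)
    (fun i j => τ.arr 0 (τ.arr 3 i 0) (τ.arr 3 j 0)) hτ2 ?_).mono (hmono _) fun _ h => h) ?_
  · intro υ _ harr _ _
    simp only [Expr.eval, harr 0 (by omega), harr 3 (by omega)]
  rintro υ ⟨g1, g2, g3⟩
  refine Runs.seq (S := N * (N * (3 + 12) + 16) + 7) (T := 2 + 4 + 1)
    ((Runs.fill (n := c.S.card) (by omega) (by omega) (by omega) (fun i j => υ.arr 1 i j) ((g1 2 (by omega) (by omega)).trans hτ2) ?_).mono (hmono _)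
      fun _ h => h) ?_
  · intro υ' _ harr _ _
    simp only [Expr.eval, harr 1 (by omega)]
  rintro φ ⟨f1, f2, f3⟩
  have hvar : ∀ z, z < 4 → φ.var z = σ.var z := fun z hz => by
    rw [f1 z (by omega) (by omega), g1 z (by omega) (by omega), h1 z (by omega)]
  refine Runs.seq (S := 2) (R := fun ψ => ψ = φ.setVar 0 c.S.card) (Runs.assign
    (by simp only [Expr.eval, hvar 2 (by omega), h.var_two])) (T := 4) ?_
  rintro ψ rfl
  refine Runs.assign ?_
  let e : Fin c.S.card ≃ {v // v ∈ c.S} :=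
    Equiv.ofBijective (fun j => ⟨idx j, h4 j⟩) ((Fintype.bijective_iff_injective_and_card _).2
      ⟨fun i j hij => h3 (congrArg Subtype.val hij), by simp⟩)
  let i₁ : c.G.comap idx ≃g c.G.comap (Subtype.val : {v // v ∈ c.S} → Fin N) :=
    { toEquiv := e, map_rel_iff' := Iff.rfl }
  refine ⟨⟨c.S.card, c.G.comap idx⟩, ⟨i₁.trans (SimpleGraph.overFinIso _ rfl)⟩, rfl, ?_, ?_, ?_⟩
  · rw [State.var_setVar_of_ne _ _ (by omega), State.var_setVar_self]
  · rw [State.var_setVar_self]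
    simp only [Expr.eval]
    rw [State.var_setVar_of_ne _ _ (by omega), State.var_setVar_of_ne _ _ (by omega),
      hvar 1 (by omega), hvar 3 (by omega), h.var_one, h.var_three]
  · intro i j
    simp only [State.arr_setVar]
    rw [f3 i j i.2 j.2, g3 i j i.2 j.2, h5 i, h5 j, h2 0 (by omega), h.adj _ (h4 i) _ (h4 j)]
    rfl

/-- Reduce; then output a constant instance if the parameter has become negative or if the graph is
too large for a yes-instance, and the reduced instance otherwise. -/
noncomputable def kernelProg (L : List (Σ x : (Σ t, BoundariedGraph t), Replacement P 𝒢 x.2))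
    (C₀ : ℕ) (H₁ H₂ : FinGraph) (l₁ l₂ : ℕ) : Prog :=
  .seq (reduceProg L) (.ite (.sub (.var 3) (.var 1)) (outputProg H₁ l₁)
    (.ite (.sub (.var 2) (Expr.smul (.add (.sub (.var 1) (.var 3)) (.const 1)) C₀))
      (outputProg H₂ l₂) compressProg))

end RAM

/-! ### The main theorem -/

/-- There is a constant instance with a given answer, if there is any such instance. -/
theorem ParamGraphProblem.exists_instance_iff (P : ParamGraphProblem) {𝒢 : Set FinGraph}
    (h𝒢 : 𝒢.Nonempty) (Q : Prop) : ∃ H ∈ 𝒢, ∃ l : ℕ, ∀ G ∈ 𝒢, ∀ k : ℕ,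
      (P.Mem G k ↔ Q) → (P.Mem H l ↔ Q) := by
  -- If no instance has the answer `Q`, the premise can never be met, since the instance `(G, k)` at
  -- hand would be one; then any output will do.
  by_cases h : ∃ H ∈ 𝒢, ∃ l : ℕ, (P.Mem H l ↔ Q)
  · obtain ⟨H, hH, l, hl⟩ := h
    exact ⟨H, hH, l, fun _ _ _ _ => hl⟩
  · obtain ⟨H, hH⟩ := h𝒢
    exact ⟨H, hH, 0, fun G hG k hk => absurd ⟨G, hG, k, hk⟩ h⟩

theorem eval_le_eval (p : Polynomial ℕ) {a b : ℕ} (h : a ≤ b) : p.eval a ≤ p.eval b := by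
  rw [Polynomial.eval_eq_sum, Polynomial.eval_eq_sum]
  exact Finset.sum_le_sum fun i _ => Nat.mul_le_mul_left _ (Nat.pow_le_pow_left h i)

theorem mainTheorem2 (d : ℕ) (P : ParamGraphProblem)
    (hfii : P.FiniteIntegerIndex (boundedDegreeClass d))
    (htw : P.TreewidthBounding (boundedDegreeClass d)) :
    P.AdmitsLinearKernel (boundedDegreeClass d) := by
  classical
  have h𝒢 : ∀ G H : FinGraph, Nonempty (G.graph ≃g H.graph) → G ∈ boundedDegreeClass d →
      H ∈ boundedDegreeClass d := fun G H ⟨f⟩ hG =>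
    mem_boundedDegreeClass_of_embedding f.symm.toEmbedding hG
  have hne : (boundedDegreeClass d).Nonempty := by
    refine ⟨⟨0, ⊥⟩, ?_⟩
    change _ ≤ d
    rw [SimpleGraph.maxDegree_of_subsingleton]
    exact Nat.zero_le d
  obtain ⟨c, t, htw⟩ := htw
  obtain ⟨s, hts, L, hL⟩ := hfii.exists_replacements (t + 1 + (t + 1) * d + 1) (t + 1)
  obtain ⟨H₁, hH₁, l₁, hl₁⟩ := P.exists_instance_iff hne (P.Mem ⟨0, ⊥⟩ (-1))
  obtain ⟨H₂, hH₂, l₂, hl₂⟩ := P.exists_instance_iff hne False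
  obtain ⟨q, hq⟩ := RAM.runs_reduceProg L
  obtain ⟨T₁, hT₁⟩ := RAM.runs_outputProg H₁ l₁
  obtain ⟨T₂, hT₂⟩ := RAM.runs_outputProg H₂ l₂
  -- Chosen so that `C₀ * (k + 1)` dominates the size bound of `exists_isMatch_of_mem`: beyond it, a
  -- yes-instance contains a replaceable piece.
  set C₀ := 2 * s * (c * d) + s + c with hC₀
  let e₀ : RAM.Expr := .sub (.var 2)
    (RAM.Expr.smul (.add (.sub (.var 1) (.var 3)) (.const 1)) C₀)
  let r : Polynomial ℕ := (2 + (.X * (15 + 9) + 7) + 1) + ((.X * (.X * (7 + 12) + 16) + 7) +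
      ((.X * (.X * (3 + 12) + 16) + 7) + (2 + 4 + 1) + 1) + 1) + 1
  let p : Polynomial ℕ := q + (3 + (.C T₁ + (.C e₀.cost + (.C T₂ + r) + 1)) + 1) + 1
  refine ⟨C₀ * (d + 1) + (H₁.size + l₁) + (H₂.size + l₂) + 1, p,
    RAM.kernelProg L C₀ H₁ H₂ l₁ l₂, fun G₀ hG₀ k => ?_⟩
  suffices h : RAM.Runs (RAM.kernelProg L C₀ H₁ H₂ l₁ l₂) (RAM.input G₀ k) (p.eval G₀.n)
      fun τ => ∃ (G' : FinGraph) (k' : ℕ), RAM.Outputs τ G' k' ∧ G' ∈ boundedDegreeClass d ∧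
        (P.Mem G₀ k ↔ P.Mem G' k') ∧
        G'.size ≤ (C₀ * (d + 1) + (H₁.size + l₁) + (H₂.size + l₂) + 1) * (k + 1) ∧
        k' ≤ (C₀ * (d + 1) + (H₁.size + l₁) + (H₂.size + l₂) + 1) * (k + 1) by
    obtain ⟨τ, T, h1, h2, G', k', h3⟩ := h
    exact ⟨G', k', τ, T, h1, h2.trans (eval_le_eval p (Nat.le_add_right _ _)), h3⟩
  -- The invariant of the reduction: the current graph is in the class and, with the lowered
  -- parameter, equivalent to the input. The parameter is an integer here, as it may become
  -- negative.
  let Good : RAM.Config G₀.n → Prop := fun x =>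
    FinGraph.ofInduced x.S x.G ∈ boundedDegreeClass d ∧
      (P.Mem G₀ k ↔ P.Mem (FinGraph.ofInduced x.S x.G) ((k : ℤ) - x.sh))
  have hgood : ∀ ρ ∈ L, ∀ (x : RAM.Config G₀.n) w, Good x → ρ.1.2.IsMatch x.S x.G w →
      Good (ρ.2.newConfig x w) := by
    rintro ρ - x w ⟨h1, h2⟩ hm
    obtain ⟨h3, h4⟩ := ρ.2.newGraph_mem_and_iff h𝒢 hm h1
    refine ⟨h3, h2.trans ((h4 _).trans ?_)⟩
    have : (k : ℤ) - x.sh - ρ.2.shift = (k : ℤ) - ((x.sh + ρ.2.shift : ℕ) : ℤ) := by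
      push_cast; ring
    rw [this]
    rfl
  let x₀ : RAM.Config G₀.n := ⟨Finset.univ, G₀.graph, 0⟩
  have hx₀ : RAM.Represents k ((RAM.input G₀ k).setVar 2 G₀.n) x₀ := by
    refine ⟨rfl, rfl, ?_, rfl, fun v => ?_, fun u _ v _ => ?_, fun u v => ?_⟩
    · rw [RAM.State.var_setVar_self]; simp [x₀]
    · simp [x₀, RAM.input]
    · simp [x₀, RAM.input]
    · simp only [RAM.input, RAM.State.arr_setVar]
      split_ifs <;> omega
  have hiso : Nonempty (G₀.graph ≃g (FinGraph.ofInduced x₀.S x₀.G).graph) := by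
    refine ⟨RelIso.trans (s := (G₀.graph.comap
      (Subtype.val : {v // v ∈ (Finset.univ : Finset (Fin G₀.n))} → Fin G₀.n)).Adj) ?_
      (SimpleGraph.overFinIso _ rfl)⟩
    exact { toFun := fun v => ⟨v, Finset.mem_univ v⟩
            invFun := Subtype.val
            left_inv := fun _ => rfl
            right_inv := fun _ => rfl
            map_rel_iff' := Iff.rfl }
  have hgood₀ : Good x₀ := by
    refine ⟨h𝒢 _ _ hiso hG₀, ?_⟩
    have := P.iso_invariant _ _ k hiso
    simpa [x₀] using this
  refine (RAM.Runs.seq (hq G₀.n k Good hgood _ x₀ rfl hx₀ hgood₀) (T := 3 + (T₁ +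
    (e₀.cost + (T₂ + r.eval G₀.n) + 1)) + 1) ?_).mono (by simp [p]) fun _ h => h
  rintro τ ⟨x, hx, ⟨hxG, hxk⟩, hno⟩
  have hbig : ∀ a b : ℕ, a ≤ b → a ≤ b * (k + 1) := fun a b hab =>
    hab.trans (Nat.le_mul_of_pos_right _ (Nat.succ_pos k))
  -- The first branch is taken when the total drop exceeds `k`; then the answer is the constant one
  -- for negative parameters, and `H₁` reproduces it.
  refine RAM.Runs.ite (fun hlt => (hT₁ τ).mono le_rfl fun υ hυ => ?_) fun hle => ?_
  · simp only [RAM.Expr.eval, hx.var_one, hx.var_three] at hlt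
    refine ⟨H₁, l₁, hυ, hH₁, ?_, hbig _ _ (by omega), hbig _ _ (by omega)⟩
    have : P.Mem G₀ k ↔ P.Mem ⟨0, ⊥⟩ (-1) :=
      hxk.trans (P.neg_const _ _ _ _ (by omega) (by omega))
    exact this.trans (hl₁ G₀ hG₀ k this).symm
  simp only [RAM.Expr.eval, hx.var_one, hx.var_three] at hle
  have hk' : (k : ℤ) - x.sh = ((k - x.sh : ℕ) : ℤ) := by omega
  rw [hk'] at hxk
  have he₀ : e₀.eval τ = x.S.card - C₀ * (k - x.sh + 1) := by
    simp only [e₀, RAM.Expr.eval, RAM.Expr.eval_smul, hx.var_one, hx.var_two, hx.var_three]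
  refine RAM.Runs.ite (e := e₀) (fun hlt => (hT₂ τ).mono le_rfl fun υ hυ => ?_) fun hle' => ?_
  · rw [he₀] at hlt
    refine ⟨H₂, l₂, hυ, hH₂, ?_, hbig _ _ (by omega), hbig _ _ (by omega)⟩
    have hnot : P.Mem G₀ k ↔ False := by
      refine iff_false_intro fun hmem => ?_
      -- If the input were a yes-instance, the reduced graph would contain a piece from the table,
      -- contradicting irreducibility. So the answer is no.
      have hsize : 2 * s * (c * (k - x.sh) * d) + s + c * (k - x.sh) ≤ C₀ * (k - x.sh + 1) := by
        rw [hC₀]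
        generalize k - x.sh = m
        calc 2 * s * (c * m * d) + s + c * m = (2 * s * (c * d) + c) * m + s := by ring
          _ ≤ (2 * s * (c * d) + s + c) * m + (2 * s * (c * d) + s + c) := by
            gcongr <;> omega
          _ = (2 * s * (c * d) + s + c) * (m + 1) := by ring
      obtain ⟨b, hb, A, hA, h1, h2, w, hw⟩ := exists_isMatch_of_mem (d := d) htw hts hxG
        (hxk.1 hmem) (by omega)
      obtain ⟨⟨y, ρ⟩, hρ, rfl⟩ := hL b hb A hA h1 h2
      exact hno _ hρ w hw
    exact hnot.trans (hl₂ G₀ hG₀ k hnot).symm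
  · rw [he₀] at hle'
    refine (RAM.runs_compressProg hx).mono (by simp [r]) ?_
    rintro υ ⟨G', hG', hn, hout⟩
    have hmem := h𝒢 _ _ (hG'.map fun f => f.symm) hxG
    refine ⟨G', k - x.sh, hout, hmem, hxk.trans (P.iso_invariant _ _ _ hG').symm, ?_, ?_⟩
    · refine (FinGraph.size_le_of_mem_boundedDegreeClass hmem).trans ?_
      have h1 : x.S.card ≤ C₀ * (k + 1) :=
        (show x.S.card ≤ C₀ * (k - x.sh + 1) by omega).trans
          (Nat.mul_le_mul_left _ (by omega))
      calc G'.n * (d + 1) ≤ C₀ * (k + 1) * (d + 1) := by rw [hn]; gcongr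
        _ = C₀ * (d + 1) * (k + 1) := by ring
        _ ≤ _ := Nat.mul_le_mul_right _ (by omega)
    · calc k - x.sh ≤ 1 * (k + 1) := by omega
        _ ≤ _ := Nat.mul_le_mul_right _ (by omega)
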